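/- A finite polysquare surface (square-tiled surface) $\mathcal{P}$ is a connected surface obtained from finitely many closed unit squares with horizontal and vertical edges (the atomic squares) by identifying, by translations, the right edges in a one-to-one way with the left edges and the top edges in a one-to-one way with the bottom edges. It carries the flat path metric inherited from the squares, and its vertices are the images of the corners of the squares. A half-infinite geodesic $\mathcal{L}(t)$, $t\ge 0$, parametrized by arc length, moves along straight line segments of one constant direction across the identified edges. It is superdense on $\mathcal{P}$ if there is a constant $C>0$, depending only on $\mathcal{P}$ and $\mathcal{L}$, such that for every integer $n\ge 1$ the initial segment $\mathcal{L}(t)$, $0\le t\le Cn$, gets $(1/n)$-close to every point of $\mathcal{P}$. A real number is badly approximable if it is irrational and its continued fraction digits are bounded. Theorem. Let $\mathcal{P}$ be an arbitrary finite polysquare surface. A half-infinite geodesic that does not hit a vertex of $\mathcal{P}$ is superdense on $\mathcal{P}$ if and only if its slope is a badly approximable number. (A vertical geodesic does not have a badly approximable slope.) -/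

import Mathlib

noncomputable section

/-- The Euclidean plane. -/
abbrev Plane : Type := EuclideanSpace ℝ (Fin 2)

/-- The closed unit square `[0,1]²`; coordinate `0` is horizontal, coordinate `1` is vertical. -/
def UnitSquare : Set Plane := {p | ∀ i, p i ∈ Set.Icc (0 : ℝ) 1}

/-- The gluing data of a connected polysquare (square-tiled) surface whose atomic squares are
indexed by `S` (finite surfaces are those with `S` finite).
The right edge of the square `a` is identified by a translation with the left edge of `right a`,
and the top edge of `a` with the bottom edge of `up a`. As `right` and `up` are permutations, this
is a pairwise identification of vertical edges and a pairwise identification of horizontal edges;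
every pattern of such identifications is allowed.
Any two squares are joined by a chain of squares in which neighbours share an edge. -/
structure PolysquareSurface (S : Type*) where
  right : Equiv.Perm S
  up : Equiv.Perm S
  connected : ∀ a b : S, Relation.EqvGen (fun c d => d = right c ∨ d = up c) a b

namespace PolysquareSurface

variable {S : Type*} (P : PolysquareSurface S)

/-- The edge identifications on the disjoint union of the closed atomic squares. -/
inductive Glue : S × UnitSquare → S × UnitSquare → Prop
  | right (a : S) (p q : UnitSquare) (hp : p.1 0 = 1) (hq : q.1 0 = 0) (h : p.1 1 = q.1 1) :
      Glue (a, p) (P.right a, q)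
  | up (a : S) (p q : UnitSquare) (hp : p.1 1 = 1) (hq : q.1 1 = 0) (h : p.1 0 = q.1 0) :
      Glue (a, p) (P.up a, q)

/-- The points of the surface: the disjoint union of the closed atomic squares modulo the
equivalence relation generated by the edge identifications. -/
def Point : Type _ := Quot P.Glue

/-- The point of the surface at position `p` in the square `a`. -/
def pt (a : S) (p : UnitSquare) : P.Point := Quot.mk _ (a, p)

/-- The vertices of the surface: the images of the corners of the atomic squares. -/
def IsVertex (x : P.Point) : Prop :=
  ∃ (a : S) (p : UnitSquare), (∀ i, p.1 i = 0 ∨ p.1 i = 1) ∧ x = P.pt a p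

/-- `P.Chain x y l`: the points `x` and `y` are joined by a broken line of length `l`, each piece
of which is a straight segment in one closed atomic square. -/
inductive Chain (x : P.Point) : P.Point → ℝ → Prop
  | refl : Chain x x 0
  | step (a : S) (p q : UnitSquare) (l : ℝ) (h : Chain x (P.pt a p) l) :
      Chain x (P.pt a q) (l + dist p q)

/-- The flat (path) metric of the surface: the infimum of the lengths of the broken lines that
join two points. -/
def flatDist (x y : P.Point) : ℝ := sInf {l | P.Chain x y l}

/-- On the set of times `I` the curve `L` is a straight segment with velocity `v` that stays in one
closed atomic square. -/
def StraightOn (v : Plane) (L : ℝ → P.Point) (I : Set ℝ) : Prop :=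
  ∃ (a : S) (p : Plane), ∀ t ∈ I, ∃ h : p + t • v ∈ UnitSquare, L t = P.pt a ⟨p + t • v, h⟩

/-- `L` restricted to `[0, ∞)` is a half-infinite geodesic with arc-length parametrization and
(constant) direction `v`: immediately after every time `t₀ ≥ 0`, and immediately before every time
`t₀ > 0`, it is a straight segment with velocity `v`, where `v` is a unit vector. (The continuation
after a time `t₀` is unique unless `L t₀` is a vertex.) -/
def IsGeodesic (v : Plane) (L : ℝ → P.Point) : Prop :=
  ‖v‖ = 1 ∧
  ∀ t₀ : ℝ, 0 ≤ t₀ →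
    (∃ ε > 0, P.StraightOn v L (Set.Icc t₀ (t₀ + ε))) ∧
    (0 < t₀ → ∃ ε > 0, P.StraightOn v L (Set.Icc (t₀ - ε) t₀))

/-- `L` is superdense: for some constant `C` and every integer `n ≥ 1`, the initial segment `L t`,
`0 ≤ t ≤ C n`, gets `(1/n)`-close to every point of the surface. -/
def IsSuperdense (L : ℝ → P.Point) : Prop :=
  ∃ C : ℝ, 0 < C ∧ ∀ n : ℕ, 1 ≤ n → ∀ x : P.Point,
    ∃ t : ℝ, 0 ≤ t ∧ t ≤ C * n ∧ P.flatDist x (L t) ≤ 1 / n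

end PolysquareSurface

/-- An irrational number `α = [a₀; a₁, a₂, …]` is badly approximable if its continued fraction
digits are bounded from above (`a₀` is the head, `a₁, a₂, …` are the partial denominators). -/
def BadlyApproximable (α : ℝ) : Prop :=
  Irrational α ∧ ∃ A : ℝ, (GenContFract.of α).h ≤ A ∧
    ∀ (i : ℕ) (a : ℝ), (GenContFract.of α).partDens.get? i = some a → a ≤ A

end

/-!
**Necessity.** Every atomic square covers the torus `(ℝ/ℤ)²`, so a character `(x, y) ↦ m x + k y` of
the torus is a function on the surface. It is Lipschitz for the flat metric with constant
`|m| + |k|`, and it changes at the constant rate `m v₀ + k v₁` along the geodesic. A superdense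
geodesic must bring the character near the antipode of its initial value within a time proportional
to `|m| + |k|`, which bounds `|m v₀ + k v₁| (|m| + |k|)` from below
(`IsSuperdense.exists_le_abs_mul`). For the slope this is the Diophantine condition that
characterizes badly approximable numbers (`badlyApproximable_of_le_abs_sub`, and conversely
`BadlyApproximable.exists_le_abs_sub`).

**Sufficiency.** After reflecting the squares the direction may be taken positive. As the geodesic
avoids the vertices, it is determined by its position, and its successive positions on the vertical
edges form an orbit of a skew product `skewRotation` over the rotation of `[0, 1)` by the slope `β`,
with fibre the set `S` of squares. To this skew product Rauzy induction is applied: the first return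
map to `S × [0, l)`, for suitable lengths `l`, exchanges two intervals and acts on the fibre by a
permutation on each of them, and these two permutations act jointly transitively on `S` at every
stage, because each stage arises from the previous one by replacing one generator by a product.
As `β` is badly approximable, the two intervals and the two return times are comparable at every
stage, and the combinatorics is bounded.

Quantitative minimality (`RauzyStage.exists_card_visited`) then follows by counting. Passing to a
deeper stage can only decrease the set of fibres in which an orbit visits the induction interval.
If this set stays the same while the induction uses steps of both types, it is invariant under a
jointly transitive pair of permutations, so it is all of `S`; otherwise the coarser stage sees at
least one fibre more. After `|S|` such refinements, which cost a bounded factor in time, all fibres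
are visited, and the towers over the induction interval spread this to all of `S × [0, 1)`.
-/

noncomputable section

/-! ### Continued fractions and Diophantine lower bounds -/

theorem Irrational.not_terminatedAt_of {α : ℝ} (hα : Irrational α) (n : ℕ) :
    ¬ (GenContFract.of α).TerminatedAt n := fun h => by
  obtain ⟨q, hq⟩ := GenContFract.exists_rat_eq_of_terminates (v := α) ⟨n, h⟩
  exact hα ⟨q, hq.symm⟩

theorem Irrational.exists_int_contsAux {α : ℝ} (hα : Irrational α) (n : ℕ) :
    (∃ a b : ℤ, (GenContFract.of α).contsAux n = ⟨a, b⟩) ∧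
      ∃ a b : ℤ, (GenContFract.of α).contsAux (n + 1) = ⟨a, b⟩ := by
  induction n with
  | zero =>
    exact ⟨⟨1, 0, by simp [GenContFract.contsAux]⟩, ⟨⌊α⌋, 1, by simp [GenContFract.contsAux]⟩⟩
  | succ n ih =>
    refine ⟨ih.2, ?_⟩
    obtain ⟨⟨a, b, h₁⟩, ⟨a', b', h₂⟩⟩ := ih
    obtain ⟨gp, hgp⟩ := Option.ne_none_iff_exists'.1 (hα.not_terminatedAt_of n)
    obtain ⟨h₃, z, h₄⟩ := GenContFract.of_partNum_eq_one_and_exists_int_partDen_eq hgp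
    refine ⟨z * a' + a, z * b' + b, ?_⟩
    rw [GenContFract.contsAux_recurrence hgp h₁ h₂, h₃, h₄]
    push_cast
    simp

/-- An irrational number with bounded continued fraction digits is not well approximated by
rationals: a good approximation is a convergent by Legendre's theorem, and the error of a
convergent is controlled by the next digit. -/
theorem BadlyApproximable.exists_le_abs_sub {α : ℝ} (h : BadlyApproximable α) :
    ∃ c : ℝ, 0 < c ∧ ∀ (p : ℤ) (q : ℕ), 0 < q → c / q ≤ |q * α - p| := by
  obtain ⟨hα, A, -, hA⟩ := h
  have hA1 : 1 ≤ A := by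
    obtain ⟨gp, hgp⟩ := Option.ne_none_iff_exists'.1 (hα.not_terminatedAt_of 0)
    have h1 := GenContFract.partDen_eq_s_b hgp
    exact (GenContFract.of_one_le_get?_partDen h1).trans (hA _ _ h1)
  refine ⟨1 / (A + 2), by positivity, fun p q hq => ?_⟩
  by_contra! hlt
  have hq' : (0 : ℝ) < q := by exact_mod_cast hq
  set r : ℚ := p / q with hr
  have hden : (r.den : ℝ) ≤ q := by
    have h2 : r.den ∣ q := by
      have h3 : r = Rat.divInt p q := by rw [hr, Rat.divInt_eq_div, Int.cast_natCast]
      rw [h3]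
      exact_mod_cast Rat.den_dvd p q
    exact_mod_cast Nat.le_of_dvd hq h2
  have hdpos : (0 : ℝ) < r.den := by exact_mod_cast r.den_pos
  have herr : |α - r| < 1 / ((A + 2) * (r.den : ℝ) ^ 2) := by
    have h1 : |α - r| = |q * α - p| / q := by
      rw [eq_div_iff hq'.ne', ← abs_of_pos hq', ← abs_mul, abs_of_pos hq', hr]
      congr 1
      push_cast
      field_simp
    rw [h1, div_lt_iff₀ hq']
    refine hlt.trans_le ?_
    rw [div_div, div_mul_eq_mul_div, one_mul, div_le_div_iff₀ (by positivity) (by positivity)]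
    nlinarith [mul_le_mul hden hden hdpos.le hq'.le]
  obtain ⟨n, hn⟩ := Real.exists_convs_eq_rat (ξ := α) (q := r) (herr.trans_le (by
    gcongr; linarith))
  obtain ⟨gp, hgp⟩ := Option.ne_none_iff_exists'.1 (hα.not_terminatedAt_of n)
  obtain ⟨ifp', hifp', hb'⟩ :=
    GenContFract.IntFractPair.exists_succ_get?_stream_of_gcf_of_get?_eq_some hgp
  obtain ⟨ifp, hifp, hfr0, hof⟩ := GenContFract.IntFractPair.succ_nth_stream_eq_some_iff.1 hifp'
  have hfrlt : ifp.fr⁻¹ ≤ A + 1 := by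
    have h1 : gp.b ≤ A := hA n _ (GenContFract.partDen_eq_s_b hgp)
    have h2 : (⌊ifp.fr⁻¹⌋ : ℝ) = gp.b := by
      rw [← hb', ← hof]; rfl
    have := Int.lt_floor_add_one ifp.fr⁻¹
    linarith
  have hsub := GenContFract.sub_convs_eq hifp
  simp only [hfr0, if_false] at hsub
  obtain ⟨⟨a, b, h₁⟩, ⟨a', b', h₂⟩⟩ := hα.exists_int_contsAux n
  have hdet : (a : ℝ) * b' - b * a' = (-1) ^ n := by
    cases n with
    | zero =>
      have e1 : (a : ℝ) = 1 := by simpa [GenContFract.contsAux] using (congrArg (·.a) h₁).symm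
      have e2 : (b : ℝ) = 0 := by simpa [GenContFract.contsAux] using (congrArg (·.b) h₁).symm
      have e3 : (b' : ℝ) = 1 := by simpa [GenContFract.contsAux] using (congrArg (·.b) h₂).symm
      rw [e1, e2, e3]; simp
    | succ m =>
      have := (SimpContFract.of α).determinant (n := m) (hα.not_terminatedAt_of m)
      simp only [GenContFract.num_eq_conts_a, GenContFract.den_eq_conts_b,
        GenContFract.nth_cont_eq_succ_nth_contAux] at this
      change ((GenContFract.of α).contsAux _).a * ((GenContFract.of α).contsAux _).b -
        ((GenContFract.of α).contsAux _).b * ((GenContFract.of α).contsAux _).a = _ at this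
      rwa [h₁, h₂] at this
  have hb'1 : (1 : ℝ) ≤ b' := by
    have := GenContFract.succ_nth_fib_le_of_nth_den (v := α) (n := n)
      (Or.inr (hα.not_terminatedAt_of _))
    rw [GenContFract.den_eq_conts_b, GenContFract.nth_cont_eq_succ_nth_contAux, h₂] at this
    refine le_trans ?_ this
    exact_mod_cast Nat.fib_pos.2 n.succ_pos
  have hbb' : (0 : ℝ) ≤ b ∧ (b : ℝ) ≤ b' := by
    have h0 := GenContFract.zero_le_of_contsAux_b (v := α) (n := n)
    rw [h₁] at h0
    refine ⟨h0, ?_⟩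
    cases n with
    | zero =>
      have e2 : (b : ℝ) = 0 := by simpa [GenContFract.contsAux] using (congrArg (·.b) h₁).symm
      linarith
    | succ m =>
      have := GenContFract.of_den_mono (v := α) (n := m)
      simp only [GenContFract.den_eq_conts_b, GenContFract.nth_cont_eq_succ_nth_contAux] at this
      rwa [h₁, h₂] at this
  have hconv : (r : ℝ) = a' / b' := by
    rw [← hn, GenContFract.conv_eq_num_div_den, GenContFract.num_eq_conts_a,
      GenContFract.den_eq_conts_b, GenContFract.nth_cont_eq_succ_nth_contAux, h₂]
  have hb'0 : 0 < b' := by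
    have : (0 : ℝ) < b' := by linarith
    exact_mod_cast this
  have hcop : Nat.Coprime a'.natAbs b'.natAbs := by
    rw [← Int.isCoprime_iff_nat_coprime]
    have hdet' : a * b' - b * a' = (-1) ^ n := by exact_mod_cast hdet
    refine ⟨-(-1) ^ n * b, (-1) ^ n * a, ?_⟩
    have hs : ((-1 : ℤ) ^ n) * (-1) ^ n = 1 := by rw [← mul_pow]; simp
    linear_combination ((-1 : ℤ) ^ n) * hdet' + hs
  have hrden : (r.den : ℤ) = b' := by
    have : r = (a' : ℚ) / (b' : ℚ) := by
      have h1 : (r : ℝ) = ((a' / b' : ℚ) : ℝ) := by rw [hconv]; push_cast; rfl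
      exact_mod_cast h1
    rw [this]
    exact Rat.den_div_eq_of_coprime hb'0 hcop
  have hrden' : (r.den : ℝ) = b' := by exact_mod_cast hrden
  rw [hn, h₁, h₂] at hsub
  rw [hsub, abs_div, abs_pow, abs_neg, abs_one, one_pow, hrden'] at herr
  have hfr : 0 < ifp.fr⁻¹ := inv_pos.2 (lt_of_le_of_ne
    (GenContFract.IntFractPair.nth_stream_fr_nonneg hifp) hfr0.symm)
  have hpos : (0 : ℝ) < b' * (ifp.fr⁻¹ * b' + b) := by
    have := mul_pos hfr (lt_of_lt_of_le one_pos hb'1)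
    have h2 := hbb'.1
    positivity
  rw [abs_of_pos hpos, one_div_lt_one_div hpos (by positivity)] at herr
  nlinarith [mul_le_mul_of_nonneg_right hfrlt (show (0 : ℝ) ≤ b' * b' by positivity),
    mul_le_mul_of_nonneg_left hbb'.2 (show (0 : ℝ) ≤ b' by positivity)]

theorem badlyApproximable_of_le_abs_sub {α c : ℝ} (hc : 0 < c)
    (h : ∀ (p : ℤ) (q : ℕ), 0 < q → c / q ≤ |q * α - p|) : BadlyApproximable α := by
  have hα : Irrational α := by
    rintro ⟨r, rfl⟩
    have := h r.num r.den r.den_pos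
    have h1 : (r.den : ℝ) * r - r.num = 0 := by
      have := Rat.den_mul_eq_num r
      rw [sub_eq_zero]
      exact_mod_cast this
    rw [h1, abs_zero] at this
    have hd : (0 : ℝ) < r.den := by exact_mod_cast r.den_pos
    have : 0 < c / r.den := by positivity
    linarith
  refine ⟨hα, max ((GenContFract.of α).h) (1 / c), le_max_left _ _, fun n b hb => ?_⟩
  refine le_trans ?_ (le_max_right _ _)
  have hb1 := GenContFract.of_one_le_get?_partDen hb
  have herr := GenContFract.abs_sub_convergents_le' hb
  obtain ⟨-, ⟨a', b', h₂⟩⟩ := hα.exists_int_contsAux n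
  have hB : (GenContFract.of α).dens n = b' := by
    rw [GenContFract.den_eq_conts_b, GenContFract.nth_cont_eq_succ_nth_contAux, h₂]
  have hA : (GenContFract.of α).nums n = a' := by
    rw [GenContFract.num_eq_conts_a, GenContFract.nth_cont_eq_succ_nth_contAux, h₂]
  have hb'1 : (1 : ℝ) ≤ b' := by
    have := GenContFract.succ_nth_fib_le_of_nth_den (v := α) (n := n)
      (Or.inr (hα.not_terminatedAt_of _))
    rw [hB] at this
    refine le_trans ?_ this
    exact_mod_cast Nat.fib_pos.2 n.succ_pos
  have hb'0 : (0 : ℝ) < b' := by linarith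
  lift b' to ℕ using (by exact_mod_cast hb'0.le)
  push_cast at hb'0 hb'1 hB
  rw [GenContFract.conv_eq_num_div_den, hA, hB] at herr
  have h3 := h a' b' (by exact_mod_cast hb'0)
  have h4 : |α - a' / b'| = |b' * α - a'| / b' := by
    rw [eq_div_iff hb'0.ne', ← abs_of_pos hb'0, ← abs_mul, abs_of_pos hb'0]
    congr 1
    field_simp
  rw [h4, div_le_iff₀ hb'0] at herr
  have h5 := h3.trans herr
  have h6 : 1 / (b * b' * b') * b' = 1 / (b * b') := by field_simp
  rw [h6, div_le_div_iff₀ hb'0 (by positivity)] at h5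
  rw [le_div_iff₀ hc]
  nlinarith

/-! ### Induction along a real interval -/

/-- Real induction: a property that holds at `a`, persists for a short time to the right, and
passes to limits from the left, holds on `[a, b]`. -/
theorem forall_mem_Icc_of_local {a b : ℝ} {R : ℝ → Prop} (h0 : R a)
    (right : ∀ t, a ≤ t → t < b → R t → ∃ ε > 0, ∀ s, t < s → s < t + ε → s ≤ b → R s)
    (left : ∀ t, a < t → t ≤ b → (∀ s, a ≤ s → s < t → R s) → R t) :
    ∀ t ∈ Set.Icc a b, R t := by
  intro t ht
  by_contra hneg
  set N : Set ℝ := {s | a ≤ s ∧ s ≤ b ∧ ¬ R s} with hN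
  have hbdd : BddBelow N := ⟨a, fun s hs => hs.1⟩
  have hne : N.Nonempty := ⟨t, ht.1, ht.2, hneg⟩
  set m := sInf N with hm
  have ham : a ≤ m := le_csInf hne fun s hs => hs.1
  have hmb : m ≤ b := (csInf_le hbdd ⟨ht.1, ht.2, hneg⟩).trans ht.2
  have hlt : ∀ s, a ≤ s → s < m → R s := fun s hs hsm => by
    by_contra hc
    exact absurd (csInf_le hbdd ⟨hs, hsm.le.trans hmb, hc⟩) (not_le.2 hsm)
  have hRm : R m := by
    rcases ham.eq_or_lt with h | h
    · rwa [← h]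
    · exact left m h hmb hlt
  have hmb' : m < b := by
    rcases hmb.eq_or_lt with h | h
    · obtain ⟨s, hs, hs'⟩ := hne
      have h1 : m ≤ s := csInf_le hbdd ⟨hs, hs'⟩
      have : s = m := le_antisymm (hs'.1.trans h.ge) h1
      exact absurd (this ▸ hRm) hs'.2
    · exact h
  obtain ⟨ε, hε, hR⟩ := right m ham hmb' hRm
  obtain ⟨s, hs, hs'⟩ := exists_lt_of_csInf_lt hne (show sInf N < m + ε by linarith)
  have h1 : m ≤ s := csInf_le hbdd hs
  rcases h1.eq_or_lt with h | h
  · exact hs.2.2 (h ▸ hRm)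
  · exact hs.2.2 (hR s h hs' hs.2.1)

namespace PolysquareSurface

variable {S : Type*} {P : PolysquareSurface S}

/-! ### The flat metric -/

theorem Chain.nonneg {x y : P.Point} {l : ℝ} (h : P.Chain x y l) : 0 ≤ l := by
  induction h with
  | refl => exact le_rfl
  | step a p q l _ ih => exact add_nonneg ih dist_nonneg

theorem Chain.trans {x y z : P.Point} {l m : ℝ} (h : P.Chain x y l) (h' : P.Chain y z m) :
    P.Chain x z (l + m) := by
  induction h' with
  | refl => simpa using h
  | step a p q m _ ih => rw [← add_assoc]; exact .step a p q _ ih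

theorem chain_pt_pt (a : S) (p q : UnitSquare) : P.Chain (P.pt a p) (P.pt a q) (dist p q) := by
  simpa using Chain.step a p q 0 .refl

theorem flatDist_pt_pt_le (a : S) (p q : UnitSquare) :
    P.flatDist (P.pt a p) (P.pt a q) ≤ dist p q :=
  csInf_le ⟨0, fun _ hl => hl.nonneg⟩ (chain_pt_pt a p q)

/-- The point of the closed unit square with the given coordinates. -/
def sq (x y : ℝ) (hx : x ∈ Set.Icc (0 : ℝ) 1) (hy : y ∈ Set.Icc (0 : ℝ) 1) : UnitSquare :=
  ⟨!₂[x, y], fun i => by fin_cases i <;> simpa⟩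

theorem sq_eta (p : UnitSquare) : sq (p.1 0) (p.1 1) (p.2 0) (p.2 1) = p := by
  apply Subtype.ext
  ext i
  fin_cases i <;> rfl

theorem pt_right (a : S) {y : ℝ} (h1 h0 hy) :
    P.pt a (sq 1 y h1 hy) = P.pt (P.right a) (sq 0 y h0 hy) :=
  Quot.sound (.right a _ _ rfl rfl rfl)

theorem pt_up (a : S) {x : ℝ} (h1 h0 hx) :
    P.pt a (sq x 1 hx h1) = P.pt (P.up a) (sq x 0 hx h0) :=
  Quot.sound (.up a _ _ rfl rfl rfl)

/-- By connectedness, the infimum that defines the flat distance is over a nonempty set. -/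
theorem exists_chain (x y : P.Point) : ∃ l, P.Chain x y l := by
  obtain ⟨⟨a, p⟩, rfl⟩ := Quot.exists_rep x
  obtain ⟨⟨b, q⟩, rfl⟩ := Quot.exists_rep y
  have m0 : (0 : ℝ) ∈ Set.Icc (0 : ℝ) 1 := by simp
  have m1 : (1 : ℝ) ∈ Set.Icc (0 : ℝ) 1 := by simp
  suffices h : ∀ a b, Relation.EqvGen (fun c d => d = P.right c ∨ d = P.up c) a b →
      (∀ p q, ∃ l, P.Chain (P.pt a p) (P.pt b q) l) ∧ ∀ p q, ∃ l, P.Chain (P.pt b q) (P.pt a p) l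
    from (h a b (P.connected a b)).1 p q
  intro a b h
  induction h with
  | rel a b h =>
    have key : ∃ u w, P.pt a u = P.pt b w := by
      rcases h with rfl | rfl
      · exact ⟨_, _, pt_right a m1 m0 m0⟩
      · exact ⟨_, _, pt_up a m1 m0 m0⟩
    obtain ⟨u, w, huw⟩ := key
    exact ⟨fun p q => ⟨_, (huw ▸ chain_pt_pt a p u).trans (chain_pt_pt b w q)⟩,
      fun p q => ⟨_, (huw ▸ chain_pt_pt b q w : P.Chain _ (P.pt a u) _).trans
        (chain_pt_pt a u p)⟩⟩
  | refl a => exact ⟨fun p q => ⟨_, chain_pt_pt a p q⟩, fun p q => ⟨_, chain_pt_pt a q p⟩⟩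
  | symm a b _ ih => exact ⟨fun p q => ih.2 q p, fun p q => ih.1 q p⟩
  | trans a b c _ _ ih ih' =>
    refine ⟨fun p q => ?_, fun p q => ?_⟩
    · obtain ⟨l, hl⟩ := ih.1 p p
      obtain ⟨m, hm⟩ := ih'.1 p q
      exact ⟨_, hl.trans hm⟩
    · obtain ⟨l, hl⟩ := ih'.2 p q
      obtain ⟨m, hm⟩ := ih.2 p p
      exact ⟨_, hl.trans hm⟩

/-! ### Characters of the torus and necessity -/

/-- The character `(x, y) ↦ m x + k y` of the torus `(ℝ/ℤ)²`, pulled back to the surface by the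
covering map (branched over one point) that sends every atomic square to the torus. -/
def character (P : PolysquareSurface S) (m k : ℤ) : P.Point → UnitAddCircle :=
  Quot.lift (fun z => ((m * z.2.1 0 + k * z.2.1 1 : ℝ) : UnitAddCircle)) (by
    have hz : ∀ j : ℤ, ((j : ℝ) : UnitAddCircle) = 0 := fun j => by
      rw [AddCircle.coe_eq_zero_iff]; exact ⟨j, by simp⟩
    rintro _ _ (⟨a, p, q, hp, hq, h⟩ | ⟨a, p, q, hp, hq, h⟩)
    · simp only [hp, hq, h, mul_one, mul_zero, zero_add, AddCircle.coe_add, hz]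
    · simp only [hp, hq, h, mul_one, mul_zero, add_zero, AddCircle.coe_add, hz])

theorem character_pt (m k : ℤ) (a : S) (p : UnitSquare) :
    P.character m k (P.pt a p) = ((m * p.1 0 + k * p.1 1 : ℝ) : UnitAddCircle) := rfl

theorem Chain.norm_character_sub_le (m k : ℤ) {x y : P.Point} {l : ℝ} (h : P.Chain x y l) :
    ‖P.character m k x - P.character m k y‖ ≤ (|(m : ℝ)| + |(k : ℝ)|) * l := by
  induction h with
  | refl => simp
  | step a p q l _ ih =>
    have h1 : ‖P.character m k (P.pt a p) - P.character m k (P.pt a q)‖ ≤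
        (|(m : ℝ)| + |(k : ℝ)|) * dist p q := by
      rw [character_pt, character_pt, ← AddCircle.coe_sub]
      refine (QuotientAddGroup.norm_mk_le_norm).trans ?_
      have hc : ∀ i, |p.1 i - q.1 i| ≤ dist p q := fun i => by
        rw [Subtype.dist_eq, dist_eq_norm]
        simpa using PiLp.norm_apply_le (p.1 - q.1) i
      rw [Real.norm_eq_abs]
      calc |(m : ℝ) * p.1 0 + k * p.1 1 - (m * q.1 0 + k * q.1 1)|
          = |m * (p.1 0 - q.1 0) + k * (p.1 1 - q.1 1)| := by congr 1; ring
        _ ≤ |(m : ℝ)| * |p.1 0 - q.1 0| + |(k : ℝ)| * |p.1 1 - q.1 1| := by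
          rw [← abs_mul, ← abs_mul]; exact abs_add_le _ _
        _ ≤ _ := by
          rw [add_mul]
          gcongr
          · exact hc 0
          · exact hc 1
    calc _ ≤ _ := norm_sub_le_norm_sub_add_norm_sub _ (P.character m k (P.pt a p)) _
      _ ≤ _ := by rw [mul_add]; exact add_le_add ih h1

theorem norm_character_sub_le_flatDist {m k : ℤ} (hmk : m ≠ 0 ∨ k ≠ 0) (x y : P.Point) :
    ‖P.character m k x - P.character m k y‖ ≤ (|(m : ℝ)| + |(k : ℝ)|) * P.flatDist x y := by
  have hpos : 0 < |(m : ℝ)| + |(k : ℝ)| := by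
    rcases hmk with h | h
    · have : 0 < |(m : ℝ)| := by simpa using h
      positivity
    · have : 0 < |(k : ℝ)| := by simpa using h
      positivity
  rw [mul_comm, ← div_le_iff₀ hpos]
  refine le_csInf (exists_chain x y) fun l hl => ?_
  rw [div_le_iff₀ hpos, mul_comm]
  exact hl.norm_character_sub_le m k

/-- Along a geodesic a character grows linearly, with slope determined by the direction. -/
theorem IsGeodesic.character_eq {v : Plane} {L : ℝ → P.Point} (hL : P.IsGeodesic v L) (m k : ℤ)
    {t : ℝ} (ht : 0 ≤ t) :
    P.character m k (L t) =
      P.character m k (L 0) + ((t * (m * v 0 + k * v 1) : ℝ) : UnitAddCircle) := by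
  have key : ∀ I, P.StraightOn v L I → ∃ θ, ∀ s ∈ I,
      P.character m k (L s) = θ + ((s * (m * v 0 + k * v 1) : ℝ) : UnitAddCircle) := by
    rintro I ⟨a, p, h⟩
    refine ⟨((m * p 0 + k * p 1 : ℝ) : UnitAddCircle), fun s hs => ?_⟩
    obtain ⟨h1, h2⟩ := h s hs
    rw [h2, character_pt, ← AddCircle.coe_add]
    congr 1
    simp
    ring
  refine forall_mem_Icc_of_local (a := 0) (b := t) (R := fun t => P.character m k (L t) =
      P.character m k (L 0) + ((t * (m * v 0 + k * v 1) : ℝ) : UnitAddCircle))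
      (by simp) ?_ ?_ t ⟨ht, le_rfl⟩
  · intro t ht _ hR
    obtain ⟨ε, hε, hs⟩ := (hL.2 t ht).1
    obtain ⟨θ, hθ⟩ := key _ hs
    refine ⟨ε, hε, fun s h1 h2 _ => ?_⟩
    have := hθ t ⟨le_rfl, by linarith⟩
    rw [hR] at this
    rw [hθ s ⟨h1.le, h2.le⟩, add_right_cancel this]
  · intro t ht _ hR
    obtain ⟨ε, hε, hs⟩ := (hL.2 t ht.le).2 ht
    obtain ⟨θ, hθ⟩ := key _ hs
    have h1 : max 0 (t - ε) < t := max_lt ht (by linarith)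
    have := hθ (max 0 (t - ε)) ⟨le_max_right _ _, h1.le⟩
    rw [hR _ (le_max_left _ _) h1] at this
    rw [hθ t ⟨by linarith, le_rfl⟩, add_right_cancel this]

theorem exists_mem_Icc_coe_intCast_mul_eq {k : ℤ} (hk : k ≠ 0) (θ : UnitAddCircle) :
    ∃ r ∈ Set.Icc (0 : ℝ) 1, ((k * r : ℝ) : UnitAddCircle) = θ := by
  obtain ⟨r, rfl⟩ := QuotientAddGroup.mk_surjective θ
  have hk' : (k : ℝ) ≠ 0 := by exact_mod_cast hk
  refine ⟨Int.fract (r / k), ⟨Int.fract_nonneg _, (Int.fract_lt_one _).le⟩, ?_⟩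
  refine QuotientAddGroup.eq.2 ⟨k * ⌊r / k⌋, ?_⟩
  have h : k * ((⌊r / k⌋ : ℝ) + Int.fract (r / k)) = r := by
    rw [Int.floor_add_fract, mul_div_cancel₀ _ hk']
  simp
  linarith

theorem exists_character_eq [Nonempty S] {m k : ℤ} (hmk : m ≠ 0 ∨ k ≠ 0) (θ : UnitAddCircle) :
    ∃ x, P.character m k x = θ := by
  have m0 : (0 : ℝ) ∈ Set.Icc (0 : ℝ) 1 := by simp
  inhabit S
  rcases hmk with h | h
  · obtain ⟨r, hr, rfl⟩ := exists_mem_Icc_coe_intCast_mul_eq h θ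
    exact ⟨P.pt default (sq r 0 hr m0), by simp [character_pt, sq]⟩
  · obtain ⟨r, hr, rfl⟩ := exists_mem_Icc_coe_intCast_mul_eq h θ
    exact ⟨P.pt default (sq 0 r m0 hr), by simp [character_pt, sq]⟩

/-- If a geodesic is superdense, then no character is nearly constant along it: within time `C n`
with `n` a multiple of the frequency, the character must come near the antipode of its initial
value. -/
theorem IsSuperdense.exists_le_abs_mul {v : Plane} {L : ℝ → P.Point} (hL : P.IsGeodesic v L)
    (h : P.IsSuperdense L) : ∃ c : ℝ, 0 < c ∧ ∀ m k : ℤ, m ≠ 0 ∨ k ≠ 0 →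
      c ≤ |m * v 0 + k * v 1| * (|(m : ℝ)| + |(k : ℝ)|) := by
  obtain ⟨C, hC, h⟩ := h
  have : Nonempty S := by
    obtain ⟨⟨a, p⟩, -⟩ := Quot.exists_rep (L 0)
    exact ⟨a⟩
  refine ⟨1 / (16 * C), by positivity, fun m k hmk => ?_⟩
  set M : ℕ := m.natAbs + k.natAbs with hM
  have hMr : (M : ℝ) = |(m : ℝ)| + |(k : ℝ)| := by
    rw [hM]; push_cast [Nat.cast_natAbs]; rfl
  have hM0 : 0 < M := by omega
  have hM0' : (0 : ℝ) < M := by exact_mod_cast hM0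
  obtain ⟨x, hx⟩ := exists_character_eq (P := P) hmk
    (P.character m k (L 0) + ((1 / 2 : ℝ) : UnitAddCircle))
  obtain ⟨t, ht0, ht, hd⟩ := h (4 * M) (by omega) x
  have h1 := norm_character_sub_le_flatDist hmk x (L t)
  rw [hx, hL.character_eq m k ht0, add_sub_add_left_eq_sub, ← hMr] at h1
  have h2 : ‖((1 / 2 : ℝ) : UnitAddCircle)‖ = 1 / 2 := by
    simpa using AddCircle.norm_half_period_eq (p := (1 : ℝ))
  have h3 : ‖((t * (m * v 0 + k * v 1) : ℝ) : UnitAddCircle)‖ ≤ t * |m * v 0 + k * v 1| := by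
    refine (QuotientAddGroup.norm_mk_le_norm).trans ?_
    rw [Real.norm_eq_abs, abs_mul, abs_of_nonneg ht0]
  have h4 := norm_sub_norm_le ((1 / 2 : ℝ) : UnitAddCircle)
    ((t * (m * v 0 + k * v 1) : ℝ) : UnitAddCircle)
  have h5 : M * P.flatDist x (L t) ≤ 1 / 4 := by
    calc M * P.flatDist x (L t) ≤ M * (1 / (4 * M : ℕ)) := by gcongr
      _ = 1 / 4 := by push_cast; field_simp
  have h6 : t * |m * v 0 + k * v 1| ≤ C * (4 * M : ℕ) * |m * v 0 + k * v 1| := by gcongr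
  push_cast at h6
  rw [← hMr, div_le_iff₀ (by positivity)]
  nlinarith

theorem IsSuperdense.badlyApproximable {v : Plane} {L : ℝ → P.Point} (hL : P.IsGeodesic v L)
    (h : P.IsSuperdense L) : v 0 ≠ 0 ∧ BadlyApproximable (v 1 / v 0) := by
  obtain ⟨c, hc, h⟩ := h.exists_le_abs_mul hL
  have hv : v 0 ≠ 0 := by
    intro h0
    have := h 1 0 (by simp)
    simp [h0] at this
    linarith
  refine ⟨hv, ?_⟩
  set α := v 1 / v 0 with hα
  have hv1 : v 1 = α * v 0 := by rw [hα]; field_simp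
  have hvpos : 0 < |v 0| := abs_pos.2 hv
  refine badlyApproximable_of_le_abs_sub (c := min 1 (c / ((|α| + 2) * |v 0|)))
    (by positivity) fun p q hq => ?_
  have hq1 : (1 : ℝ) ≤ q := by exact_mod_cast hq
  rcases le_or_gt 1 |q * α - p| with h1 | h1
  · refine le_trans ?_ h1
    rw [div_le_one (by linarith)]
    exact (min_le_left _ _).trans hq1
  · have h2 := h (-p) q (Or.inr (by exact_mod_cast hq.ne'))
    push_cast at h2
    have h3 : -(p : ℝ) * v 0 + q * v 1 = (q * α - p) * v 0 := by rw [hv1]; ring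
    rw [h3, abs_mul, abs_neg, Nat.abs_cast] at h2
    have h4 : |(p : ℝ)| ≤ q * |α| + 1 := by
      have h5 : |(p : ℝ)| ≤ |q * α| + |q * α - p| := by
        have := abs_sub (q * α) (q * α - p)
        simpa using this
      rw [abs_mul, Nat.abs_cast] at h5
      linarith
    refine (div_le_div_of_nonneg_right (min_le_right _ _) (by linarith)).trans ?_
    rw [div_div, div_le_iff₀ (by positivity)]
    refine h2.trans ?_
    have h6 : |(p : ℝ)| + q ≤ (|α| + 2) * q := by nlinarith
    calc |q * α - p| * |v 0| * (|(p : ℝ)| + q) ≤ |q * α - p| * |v 0| * ((|α| + 2) * q) := by gcongr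
      _ = _ := by ring

end PolysquareSurface

/-! ### Skew products over a rotation and Rauzy induction -/

/-- The skew product over the rotation by `β` of `[0, 1)`, which is the first return map to the
vertical edges of the linear flow of slope `β`: from height `y` on the entry edge of a square, the
flow crosses `⌊y + β⌋` horizontal edges and then one vertical edge. -/
def skewRotation {S : Type*} (ρ υ : Equiv.Perm S) (β : ℝ) (z : S × ℝ) : S × ℝ :=
  (ρ ((υ ^ ⌊z.2 + β⌋) z.1), Int.fract (z.2 + β))

/-- Two permutations act transitively, phrased via invariant sets. -/
def JointlyTransitive {S : Type*} (σ τ : Equiv.Perm S) : Prop :=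
  ∀ V : Set S, (∀ s, σ s ∈ V ↔ s ∈ V) → (∀ s, τ s ∈ V ↔ s ∈ V) → V.Nonempty → ∀ s, s ∈ V

/-- A stage of Rauzy induction for a skew product `T` over the rotation by `β`. The first return map
of `T` to `S × [0, l₁ + l₂)` exchanges the intervals `[0, l₁)` and `[l₁, l₁ + l₂)`, with return
times `h₁`, `h₂`, and acts on the fibre `S` by `σ`, `τ` respectively; the towers over these two
intervals cover `S × [0, 1)`. -/
structure RauzyStage {S : Type*} (T : S × ℝ → S × ℝ) (β : ℝ) where
  l₁ : ℝ
  l₂ : ℝ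
  h₁ : ℕ
  h₂ : ℕ
  σ : Equiv.Perm S
  τ : Equiv.Perm S
  pos₁ : 0 < l₁
  pos₂ : 0 < l₂
  h₁_pos : 0 < h₁
  h₂_pos : 0 < h₂
  return₁ : ∀ s, ∀ x ∈ Set.Ico 0 l₁, T^[h₁] (s, x) = (σ s, x + l₂)
  return₂ : ∀ s, ∀ x ∈ Set.Ico l₁ (l₁ + l₂), T^[h₂] (s, x) = (τ s, x - l₁)
  tower : ∀ s, ∀ x ∈ Set.Ico (0 : ℝ) 1,
    (∃ j < h₁, ∃ r d, x - d ∈ Set.Ico 0 l₁ ∧ ∀ z ∈ Set.Ico 0 l₁, T^[j] (r, z) = (s, z + d)) ∨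
    (∃ j < h₂, ∃ r d, x - d ∈ Set.Ico l₁ (l₁ + l₂) ∧
      ∀ z ∈ Set.Ico l₁ (l₁ + l₂), T^[j] (r, z) = (s, z + d))
  transitive : JointlyTransitive σ τ
  l₁_eq : ∃ p : ℤ, l₁ = p - h₂ * β
  l₂_eq : ∃ p : ℤ, l₂ = h₁ * β - p
  area : h₁ * l₁ + h₂ * l₂ = 1

namespace RauzyStage

variable {S : Type*} {T : S × ℝ → S × ℝ} {β : ℝ}

/-- The length of the interval over which the stage is induced. -/
def len (ℓ : RauzyStage T β) : ℝ := ℓ.l₁ + ℓ.l₂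

theorem len_pos (ℓ : RauzyStage T β) : 0 < ℓ.len := add_pos ℓ.pos₁ ℓ.pos₂

/-- Inducing on `[0, l₁)` when `l₂ < l₁`. -/
def stepLeft (ℓ : RauzyStage T β) (h : ℓ.l₂ < ℓ.l₁) : RauzyStage T β where
  l₁ := ℓ.l₁ - ℓ.l₂
  l₂ := ℓ.l₂
  h₁ := ℓ.h₁
  h₂ := ℓ.h₁ + ℓ.h₂
  σ := ℓ.σ
  τ := ℓ.τ * ℓ.σ
  pos₁ := sub_pos.2 h
  pos₂ := ℓ.pos₂
  h₁_pos := ℓ.h₁_pos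
  h₂_pos := Nat.add_pos_left ℓ.h₁_pos _
  return₁ s x hx := ℓ.return₁ s x ⟨hx.1, by linarith [hx.2, ℓ.pos₂]⟩
  return₂ s x hx := by
    rw [sub_add_cancel] at hx
    rw [add_comm, Function.iterate_add_apply,
      ℓ.return₁ s x ⟨by linarith [hx.1], hx.2⟩,
      ℓ.return₂ _ _ ⟨by linarith [hx.1], by linarith [hx.2]⟩, Equiv.Perm.mul_apply]
    congr 1; ring
  tower s x hx := by
    rcases ℓ.tower s x hx with ⟨j, hj, r, d, hd, hT⟩ | ⟨j, hj, r, d, hd, hT⟩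
    · rcases lt_or_ge (x - d) (ℓ.l₁ - ℓ.l₂) with h' | h'
      · exact Or.inl ⟨j, hj, r, d, ⟨hd.1, h'⟩, fun z hz =>
          hT z ⟨hz.1, by linarith [hz.2, ℓ.pos₂]⟩⟩
      · exact Or.inr ⟨j, by omega, r, d, ⟨h', by linarith [hd.2]⟩, fun z hz =>
          hT z ⟨by linarith [hz.1], by linarith [hz.2]⟩⟩
    · refine Or.inr ⟨j + ℓ.h₁, by omega, ℓ.σ.symm r, d + ℓ.l₂,
        ⟨by linarith [hd.1], by linarith [hd.2]⟩, fun z hz => ?_⟩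
      rw [Function.iterate_add_apply, ℓ.return₁ _ z ⟨by linarith [hz.1], by linarith [hz.2]⟩,
        Equiv.apply_symm_apply, hT _ ⟨by linarith [hz.1], by linarith [hz.2]⟩]
      congr 1; ring
  transitive V hσ hτ := ℓ.transitive V hσ fun s => by
    have := hτ (ℓ.σ.symm s)
    have h' := hσ (ℓ.σ.symm s)
    rw [Equiv.Perm.mul_apply] at this
    rw [Equiv.apply_symm_apply] at this h'
    rw [this, h']
  l₁_eq := by
    obtain ⟨p, hp⟩ := ℓ.l₁_eq
    obtain ⟨q, hq⟩ := ℓ.l₂_eq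
    exact ⟨p + q, by rw [hp, hq]; push_cast; ring⟩
  l₂_eq := ℓ.l₂_eq
  area := by
    have := ℓ.area
    push_cast
    linarith

/-- Inducing on `[0, l₂)` when `l₁ < l₂`. -/
def stepRight (ℓ : RauzyStage T β) (h : ℓ.l₁ < ℓ.l₂) : RauzyStage T β where
  l₁ := ℓ.l₁
  l₂ := ℓ.l₂ - ℓ.l₁
  h₁ := ℓ.h₁ + ℓ.h₂
  h₂ := ℓ.h₂
  σ := ℓ.τ * ℓ.σ
  τ := ℓ.τ
  pos₁ := ℓ.pos₁
  pos₂ := sub_pos.2 h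
  h₁_pos := Nat.add_pos_left ℓ.h₁_pos _
  h₂_pos := ℓ.h₂_pos
  return₁ s x hx := by
    rw [add_comm, Function.iterate_add_apply, ℓ.return₁ s x hx,
      ℓ.return₂ _ _ ⟨by linarith [hx.1], by linarith [hx.2]⟩, Equiv.Perm.mul_apply]
    congr 1; ring
  return₂ s x hx := ℓ.return₂ s x ⟨hx.1, by linarith [hx.2, ℓ.pos₁]⟩
  tower s x hx := by
    rcases ℓ.tower s x hx with ⟨j, hj, r, d, hd, hT⟩ | ⟨j, hj, r, d, hd, hT⟩
    · exact Or.inl ⟨j, by omega, r, d, hd, hT⟩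
    · rcases lt_or_ge (x - d) ℓ.l₂ with h' | h'
      · exact Or.inr ⟨j, hj, r, d, ⟨hd.1, by linarith⟩, fun z hz =>
          hT z ⟨hz.1, by linarith [hz.2, ℓ.pos₁]⟩⟩
      · refine Or.inl ⟨j + ℓ.h₁, by omega, ℓ.σ.symm r, d + ℓ.l₂,
          ⟨by linarith [hd.1], by linarith [hd.2]⟩, fun z hz => ?_⟩
        rw [Function.iterate_add_apply, ℓ.return₁ _ z hz,
          Equiv.apply_symm_apply, hT _ ⟨by linarith [hz.1], by linarith [hz.2]⟩]
        congr 1; ring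
  transitive V hσ hτ := ℓ.transitive V (fun s => by rw [← hτ, ← hσ s, Equiv.Perm.mul_apply]) hτ
  l₁_eq := ℓ.l₁_eq
  l₂_eq := by
    obtain ⟨p, hp⟩ := ℓ.l₁_eq
    obtain ⟨q, hq⟩ := ℓ.l₂_eq
    exact ⟨p + q, by rw [hp, hq]; push_cast; ring⟩
  area := by
    have := ℓ.area
    push_cast
    linarith

/-! ### Bounded combinatorics for badly approximable rotations -/

theorem l₁_ne_l₂ (ℓ : RauzyStage T β) {c : ℝ} (hc : 0 < c)
    (hβ : ∀ (p : ℤ) (q : ℕ), 0 < q → c / q ≤ |q * β - p|) : ℓ.l₁ ≠ ℓ.l₂ := by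
  intro h
  obtain ⟨p, hp⟩ := ℓ.l₁_eq
  obtain ⟨q, hq⟩ := ℓ.l₂_eq
  have h0 : 0 < ℓ.h₁ + ℓ.h₂ := Nat.add_pos_left ℓ.h₁_pos _
  have h1 := hβ (p + q) (ℓ.h₁ + ℓ.h₂) h0
  have h2 : ((ℓ.h₁ + ℓ.h₂ : ℕ) : ℝ) * β - ((p + q : ℤ) : ℝ) = 0 := by push_cast; linarith
  rw [h2, abs_zero] at h1
  have h0' : (0 : ℝ) < (ℓ.h₁ + ℓ.h₂ : ℕ) := by exact_mod_cast h0
  have : 0 < c / (ℓ.h₁ + ℓ.h₂ : ℕ) := by positivity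
  linarith

/-- For a badly approximable rotation, both intervals occupy a definite proportion, since
`c ≤ l₁ h₂` and `l₂ h₂ ≤ 1` give `c l₂ ≤ l₁`, and symmetrically. -/
theorem mul_len_le (ℓ : RauzyStage T β) {c : ℝ} (hc : 0 < c)
    (hβ : ∀ (p : ℤ) (q : ℕ), 0 < q → c / q ≤ |q * β - p|) :
    c / (1 + c) * ℓ.len ≤ ℓ.l₁ ∧ c / (1 + c) * ℓ.len ≤ ℓ.l₂ := by
  obtain ⟨p, hp⟩ := ℓ.l₁_eq
  obtain ⟨q, hq⟩ := ℓ.l₂_eq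
  have k1 := hβ p ℓ.h₂ ℓ.h₂_pos
  have k2 := hβ q ℓ.h₁ ℓ.h₁_pos
  rw [abs_sub_comm, ← hp, abs_of_pos ℓ.pos₁] at k1
  rw [← hq, abs_of_pos ℓ.pos₂] at k2
  have p1 : (0 : ℝ) < ℓ.h₁ := by exact_mod_cast ℓ.h₁_pos
  have p2 : (0 : ℝ) < ℓ.h₂ := by exact_mod_cast ℓ.h₂_pos
  have a1 : ℓ.h₁ * ℓ.l₁ ≤ 1 := by nlinarith [ℓ.area, mul_pos p2 ℓ.pos₂]
  have a2 : ℓ.h₂ * ℓ.l₂ ≤ 1 := by nlinarith [ℓ.area, mul_pos p1 ℓ.pos₁]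
  rw [div_le_iff₀ p2] at k1
  rw [div_le_iff₀ p1] at k2
  have b1 : c * ℓ.l₂ ≤ ℓ.l₁ := by
    calc c * ℓ.l₂ ≤ ℓ.l₁ * ℓ.h₂ * ℓ.l₂ := by gcongr; exact ℓ.pos₂.le
      _ = ℓ.l₁ * (ℓ.h₂ * ℓ.l₂) := by ring
      _ ≤ ℓ.l₁ * 1 := by gcongr; exact ℓ.pos₁.le
      _ = _ := mul_one _
  have b2 : c * ℓ.l₁ ≤ ℓ.l₂ := by
    calc c * ℓ.l₁ ≤ ℓ.l₂ * ℓ.h₁ * ℓ.l₁ := by gcongr; exact ℓ.pos₁.le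
      _ = ℓ.l₂ * (ℓ.h₁ * ℓ.l₁) := by ring
      _ ≤ ℓ.l₂ * 1 := by gcongr; exact ℓ.pos₂.le
      _ = _ := mul_one _
  have h1c : 0 < 1 + c := by linarith
  unfold len
  constructor <;> rw [div_mul_eq_mul_div, div_le_iff₀ h1c] <;> linarith

theorem height_le (ℓ : RauzyStage T β) {κ : ℝ} (hκ : 0 < κ)
    (h : κ * ℓ.len ≤ ℓ.l₁ ∧ κ * ℓ.len ≤ ℓ.l₂) :
    (ℓ.h₁ : ℝ) ≤ 1 / κ / ℓ.len ∧ (ℓ.h₂ : ℝ) ≤ 1 / κ / ℓ.len := by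
  have p1 : (0 : ℝ) < ℓ.h₁ := by exact_mod_cast ℓ.h₁_pos
  have p2 : (0 : ℝ) < ℓ.h₂ := by exact_mod_cast ℓ.h₂_pos
  have a1 : ℓ.h₁ * ℓ.l₁ ≤ 1 := by nlinarith [ℓ.area, mul_pos p2 ℓ.pos₂]
  have a2 : ℓ.h₂ * ℓ.l₂ ≤ 1 := by nlinarith [ℓ.area, mul_pos p1 ℓ.pos₁]
  have hl := mul_pos hκ ℓ.len_pos
  rw [div_div, le_div_iff₀ hl, le_div_iff₀ hl]
  constructor
  · nlinarith [h.1]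
  · nlinarith [h.2]

theorem len_le_one (ℓ : RauzyStage T β) : ℓ.len ≤ 1 := by
  have p1 : (1 : ℝ) ≤ ℓ.h₁ := by exact_mod_cast ℓ.h₁_pos
  have p2 : (1 : ℝ) ≤ ℓ.h₂ := by exact_mod_cast ℓ.h₂_pos
  unfold len
  nlinarith [ℓ.area, ℓ.pos₁, ℓ.pos₂]

theorem exists_iterate_stepLeft (ℓ : RauzyStage T β) (k : ℕ) (hk : k * ℓ.l₂ < ℓ.l₁) :
    ∃ ℓ' : RauzyStage T β, ℓ'.l₁ = ℓ.l₁ - k * ℓ.l₂ ∧ ℓ'.l₂ = ℓ.l₂ ∧ ℓ'.h₁ = ℓ.h₁ ∧ ℓ'.σ = ℓ.σ := by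
  induction k with
  | zero => exact ⟨ℓ, by simp, rfl, rfl, rfl⟩
  | succ k ih =>
    push_cast at hk
    obtain ⟨ℓ', e1, e2, e3, e4⟩ := ih (by nlinarith [ℓ.pos₂])
    refine ⟨ℓ'.stepLeft (by rw [e1, e2]; linarith), ?_, e2, e3, e4⟩
    simp only [stepLeft, e1, e2]
    push_cast
    ring

theorem exists_iterate_stepRight (ℓ : RauzyStage T β) (k : ℕ) (hk : k * ℓ.l₁ < ℓ.l₂) :
    ∃ ℓ' : RauzyStage T β, ℓ'.l₂ = ℓ.l₂ - k * ℓ.l₁ ∧ ℓ'.l₁ = ℓ.l₁ ∧ ℓ'.h₂ = ℓ.h₂ ∧ ℓ'.τ = ℓ.τ := by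
  induction k with
  | zero => exact ⟨ℓ, by simp, rfl, rfl, rfl⟩
  | succ k ih =>
    push_cast at hk
    obtain ⟨ℓ', e1, e2, e3, e4⟩ := ih (by nlinarith [ℓ.pos₁])
    refine ⟨ℓ'.stepRight (by rw [e1, e2]; linarith), ?_, e2, e3, e4⟩
    simp only [stepRight, e1, e2]
    push_cast
    ring

/-- `ℓ'` is a deeper stage than `ℓ`, induced on an interval of the length of the shorter of the two
intervals of `ℓ`, such that going forward by `n₁` and backward by `n₂` steps leads from the smaller
interval into the larger one and acts on the fibre by `g₁` and `g₂⁻¹`. -/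
structure Refines (ℓ' ℓ : RauzyStage T β) (g₁ g₂ : Equiv.Perm S) (n₁ n₂ : ℕ) : Prop where
  len_eq : ℓ'.len = min ℓ.l₁ ℓ.l₂
  n₁_le : n₁ ≤ ℓ'.h₁ + ℓ'.h₂
  n₂_le : n₂ ≤ ℓ'.h₁ + ℓ'.h₂
  forward : ∀ s, ∀ x ∈ Set.Ico 0 ℓ'.len, ∃ y ∈ Set.Ico 0 ℓ.len, T^[n₁] (s, x) = (g₁ s, y)
  backward : ∀ s, ∀ x ∈ Set.Ico 0 ℓ'.len, ∃ y ∈ Set.Ico 0 ℓ.len, T^[n₂] (g₂.symm s, y) = (s, x)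
  transitive : JointlyTransitive g₁ g₂

/-- A maximal run of steps of one type followed by a step of the other type is a refinement: the
step of left type supplies the forward move and that of right type the backward move. -/
theorem exists_refines (ℓ : RauzyStage T β) (hne : ∀ ℓ' : RauzyStage T β, ℓ'.l₁ ≠ ℓ'.l₂) :
    ∃ (ℓ' : RauzyStage T β) (g₁ g₂ : Equiv.Perm S) (n₁ n₂ : ℕ), ℓ'.Refines ℓ g₁ g₂ n₁ n₂ := by
  -- the number of steps in a maximal run; the remainder cannot vanish, as no stage is balanced
  have hrun : ∀ a b : ℝ, 0 < b → 0 < a → ∃ k : ℕ, k * b < a ∧ a ≤ (k + 1) * b := fun a b hb ha => by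
    refine ⟨⌈a / b⌉₊ - 1, ?_, ?_⟩
    · have h0 : 0 < ⌈a / b⌉₊ := Nat.ceil_pos.2 (div_pos ha hb)
      have := Nat.ceil_lt_add_one (div_pos ha hb).le
      rw [← lt_div_iff₀ hb]
      push_cast [Nat.cast_sub h0]
      linarith
    · have h0 : 0 < ⌈a / b⌉₊ := Nat.ceil_pos.2 (div_pos ha hb)
      have := Nat.le_ceil (a / b)
      rw [← div_le_iff₀ hb]
      push_cast [Nat.cast_sub h0]
      linarith
  rcases lt_or_gt_of_ne (hne ℓ) with h | h
  · obtain ⟨k, hk, hk'⟩ := hrun ℓ.l₂ ℓ.l₁ ℓ.pos₁ ℓ.pos₂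
    obtain ⟨m, e1, e2, e3, e4⟩ := ℓ.exists_iterate_stepRight k hk
    have hlt : m.l₂ < m.l₁ := lt_of_le_of_ne (by rw [e1, e2]; linarith) (hne m).symm
    have hkl : 0 ≤ k * ℓ.l₁ := by have := ℓ.pos₁; positivity
    have hlen : (m.stepLeft hlt).len = ℓ.l₁ := by simp [stepLeft, len, e2]
    refine ⟨m.stepLeft hlt, m.σ, m.τ, m.h₁, m.h₂, ?_, ?_, ?_, ?_, ?_, m.transitive⟩
    · rw [hlen, min_eq_left h.le]
    · simp only [stepLeft]; omega
    · simp only [stepLeft]; omega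
    · rw [hlen, len]
      refine fun s x hx => ⟨_, ?_, m.return₁ s x (by rwa [e2])⟩
      exact ⟨by linarith [hx.1, m.pos₂], by linarith [hx.2]⟩
    · rw [hlen, len]
      refine fun s x hx => ⟨x + ℓ.l₁, ⟨by linarith [hx.1, ℓ.pos₁], by linarith [hx.2]⟩, ?_⟩
      rw [e3, e4, ℓ.return₂ _ _ ⟨by linarith [hx.1], by linarith [hx.2]⟩,
        Equiv.apply_symm_apply, add_sub_cancel_right]
  · obtain ⟨k, hk, hk'⟩ := hrun ℓ.l₁ ℓ.l₂ ℓ.pos₂ ℓ.pos₁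
    obtain ⟨m, e1, e2, e3, e4⟩ := ℓ.exists_iterate_stepLeft k hk
    have hlt : m.l₁ < m.l₂ := lt_of_le_of_ne (by rw [e1, e2]; linarith) (hne m)
    have hkl : 0 ≤ k * ℓ.l₂ := by have := ℓ.pos₂; positivity
    have hlen : (m.stepRight hlt).len = ℓ.l₂ := by simp [stepRight, len, e2]
    refine ⟨m.stepRight hlt, m.σ, m.τ, m.h₁, m.h₂, ?_, ?_, ?_, ?_, ?_, m.transitive⟩
    · rw [hlen, min_eq_right h.le]
    · simp only [stepRight]; omega
    · simp only [stepRight]; omega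
    · rw [hlen, len]
      refine fun s x hx => ⟨x + ℓ.l₂, ⟨by linarith [hx.1, ℓ.pos₂], by linarith [hx.2]⟩, ?_⟩
      rw [e3, e4, ℓ.return₁ _ _ ⟨hx.1, by linarith [hx.2]⟩]
    · rw [hlen, len]
      refine fun s x hx => ⟨x + m.l₁, ⟨by linarith [hx.1, m.pos₁], by linarith [hx.2]⟩, ?_⟩
      rw [m.return₂ _ _ ⟨by linarith [hx.1], by linarith [hx.2]⟩,
        Equiv.apply_symm_apply, add_sub_cancel_right]

/-! ### Quantitative minimality -/

/-- Every orbit enters the induction interval within one return time. -/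
theorem exists_iterate_mem (ℓ : RauzyStage T β) (z : S × ℝ) (hz : z.2 ∈ Set.Ico (0 : ℝ) 1) :
    ∃ t ≤ max ℓ.h₁ ℓ.h₂, (T^[t] z).2 ∈ Set.Ico 0 ℓ.len := by
  obtain ⟨s, x⟩ := z
  unfold len
  rcases ℓ.tower s x hz with ⟨j, hj, r, d, hd, hT⟩ | ⟨j, hj, r, d, hd, hT⟩
  · refine ⟨ℓ.h₁ - j, (Nat.sub_le _ _).trans (le_max_left _ _), ?_⟩
    have h1 := hT _ hd
    rw [sub_add_cancel] at h1
    rw [← h1, ← Function.iterate_add_apply, Nat.sub_add_cancel hj.le, ℓ.return₁ _ _ hd]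
    exact ⟨by linarith [hd.1, ℓ.pos₂], by linarith [hd.2]⟩
  · refine ⟨ℓ.h₂ - j, (Nat.sub_le _ _).trans (le_max_right _ _), ?_⟩
    have h1 := hT _ hd
    rw [sub_add_cancel] at h1
    rw [← h1, ← Function.iterate_add_apply, Nat.sub_add_cancel hj.le, ℓ.return₂ _ _ hd]
    exact ⟨by linarith [hd.1], by linarith [hd.2, ℓ.pos₁]⟩

/-- Within a time inversely proportional to the length of the induction interval, every orbit
visits that interval in at least `k` different fibres. If passing to a refinement does not lose
any of the visited fibres, then the set of visited fibres is invariant under both `g₁` and `g₂`,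
hence consists of all fibres; this gains one fibre at a time. -/
theorem exists_card_visited [Fintype S] {κ : ℝ} (hκ : 0 < κ)
    (hlen : ∀ ℓ : RauzyStage T β, κ * ℓ.len ≤ ℓ.l₁ ∧ κ * ℓ.len ≤ ℓ.l₂)
    (hne : ∀ ℓ : RauzyStage T β, ℓ.l₁ ≠ ℓ.l₂)
    (hmaps : Set.MapsTo T {z | z.2 ∈ Set.Ico (0 : ℝ) 1} {z | z.2 ∈ Set.Ico (0 : ℝ) 1})
    (hinj : Set.InjOn T {z | z.2 ∈ Set.Ico (0 : ℝ) 1}) (k : ℕ) (hk : k + 1 ≤ Fintype.card S) :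
    ∃ K : ℝ, 0 < K ∧ ∀ (ℓ : RauzyStage T β) (z : S × ℝ), z.2 ∈ Set.Ico (0 : ℝ) 1 →
      ∃ V : Finset S, k + 1 ≤ V.card ∧ ∀ s ∈ V, ∃ t : ℕ, t ≤ K / ℓ.len ∧
        ∃ x ∈ Set.Ico 0 ℓ.len, T^[t] z = (s, x) := by
  induction k with
  | zero =>
    refine ⟨1 / κ, by positivity, fun ℓ z hz => ?_⟩
    obtain ⟨t, ht, hx⟩ := ℓ.exists_iterate_mem z hz
    refine ⟨{(T^[t] z).1}, by simp, fun s hs => ⟨t, ?_, _, hx, ?_⟩⟩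
    · have := ℓ.height_le hκ (hlen ℓ)
      have ht' : (t : ℝ) ≤ max (ℓ.h₁ : ℝ) ℓ.h₂ := by exact_mod_cast ht
      exact ht'.trans (max_le this.1 this.2)
    · rw [Finset.mem_singleton.1 hs]
  | succ k ih =>
    obtain ⟨K, hK, ih⟩ := ih (by omega)
    refine ⟨(4 / κ + K) / κ, by positivity, fun ℓ z hz => ?_⟩
    obtain ⟨ℓ', g₁, g₂, n₁, n₂, hR⟩ := ℓ.exists_refines hne
    have hh := ℓ'.height_le hκ (hlen ℓ')
    have hl' := ℓ'.len_pos
    have hle : κ * ℓ.len ≤ ℓ'.len := by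
      rw [hR.len_eq]; exact le_min (hlen ℓ).1 (hlen ℓ).2
    have hle' : ℓ'.len ≤ ℓ.len := by
      rw [hR.len_eq, len]; exact (min_le_left _ _).trans (by linarith [ℓ.pos₂])
    have hn₁ : (n₁ : ℝ) ≤ 2 / κ / ℓ'.len := by
      have : (n₁ : ℝ) ≤ ℓ'.h₁ + ℓ'.h₂ := by exact_mod_cast hR.n₁_le
      have e : 2 / κ / ℓ'.len = 1 / κ / ℓ'.len + 1 / κ / ℓ'.len := by ring
      linarith [hh.1, hh.2]
    have hn₂ : (n₂ : ℝ) ≤ 2 / κ / ℓ'.len := by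
      have : (n₂ : ℝ) ≤ ℓ'.h₁ + ℓ'.h₂ := by exact_mod_cast hR.n₂_le
      have e : 2 / κ / ℓ'.len = 1 / κ / ℓ'.len + 1 / κ / ℓ'.len := by ring
      linarith [hh.1, hh.2]
    have htotal : 2 / κ / ℓ'.len + 2 / κ / ℓ'.len + K / ℓ'.len ≤ (4 / κ + K) / κ / ℓ.len := by
      rw [← add_div, ← add_div, div_div _ κ ℓ.len]
      have e : 2 / κ + 2 / κ + K = 4 / κ + K := by ring
      rw [e]
      have := mul_pos hκ ℓ.len_pos
      gcongr
    have hiter : ∀ n, (T^[n] z).2 ∈ Set.Ico (0 : ℝ) 1 := fun n => hmaps.iterate n hz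
    -- starting only at time `n₂` leaves room for moving backward
    obtain ⟨V', hV', hvis⟩ := ih ℓ' (T^[n₂] z) (hiter n₂)
    classical
    set W : Finset S := Finset.univ.filter fun s => ∃ t : ℕ, t ≤ (4 / κ + K) / κ / ℓ.len ∧
        ∃ x ∈ Set.Ico 0 ℓ.len, T^[t] z = (s, x) with hW
    have hWmem : ∀ s, s ∈ W ↔ ∃ t : ℕ, t ≤ (4 / κ + K) / κ / ℓ.len ∧
        ∃ x ∈ Set.Ico 0 ℓ.len, T^[t] z = (s, x) := fun s => by simp [hW]
    have p2 : 0 ≤ 2 / κ / ℓ'.len := by positivity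
    have hsub : V' ⊆ W := fun s hs => by
      obtain ⟨t, ht, x, hx, hT⟩ := hvis s hs
      refine (hWmem s).2 ⟨t + n₂, ?_, x, ⟨hx.1, hx.2.trans_le hle'⟩, ?_⟩
      · push_cast; linarith
      · rw [Function.iterate_add_apply, hT]
    have hfwd : ∀ s ∈ V', g₁ s ∈ W := fun s hs => by
      obtain ⟨t, ht, x, hx, hT⟩ := hvis s hs
      obtain ⟨y, hy, hxy⟩ := hR.forward s x hx
      refine (hWmem _).2 ⟨n₁ + (t + n₂), ?_, y, hy, ?_⟩
      · push_cast; linarith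
      · rw [Function.iterate_add_apply, Function.iterate_add_apply T t, hT, hxy]
    have hbwd : ∀ s ∈ V', g₂.symm s ∈ W := fun s hs => by
      obtain ⟨t, ht, x, hx, hT⟩ := hvis s hs
      obtain ⟨y, hy, hxy⟩ := hR.backward s x hx
      refine (hWmem _).2 ⟨t, ?_, y, hy, ?_⟩
      · linarith
      · refine hinj.iterate hmaps n₂ (hiter t) ?_ ?_
        · exact ⟨hy.1, hy.2.trans_le ℓ.len_le_one⟩
        · rw [hxy, ← hT, ← Function.iterate_add_apply, ← Function.iterate_add_apply, add_comm]
    refine ⟨W, ?_, fun s hs => (hWmem s).1 hs⟩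
    by_contra hlt
    have hVW : V' = W := Finset.eq_of_subset_of_card_le hsub (by omega)
    rw [hVW] at hfwd hbwd hV'
    have hall : ∀ s, s ∈ (W : Set S) := by
      refine hR.transitive W (fun s => ⟨fun h => ?_, fun h => hfwd s h⟩)
        (fun s => ⟨fun h => ?_, fun h => ?_⟩) ?_
      · simpa using Equiv.Perm.perm_symm_on_of_perm_on_finset hfwd h
      · simpa using hbwd _ h
      · simpa using Equiv.Perm.perm_symm_on_of_perm_on_finset (f := g₂.symm) hbwd h
      · exact Finset.card_pos.1 (by omega)
    have : W = Finset.univ := Finset.eq_univ_iff_forall.2 hall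
    rw [this, Finset.card_univ] at hlt
    omega

/-- Stages exist at every scale. -/
theorem exists_len_mem {κ δ : ℝ} (hκ : 0 < κ) (hδ : 0 < δ) (ℓ₀ : RauzyStage T β)
    (hlen : ∀ ℓ : RauzyStage T β, κ * ℓ.len ≤ ℓ.l₁ ∧ κ * ℓ.len ≤ ℓ.l₂)
    (hne : ∀ ℓ : RauzyStage T β, ℓ.l₁ ≠ ℓ.l₂) (h₀ : κ * δ ≤ ℓ₀.len) :
    ∃ ℓ : RauzyStage T β, κ * δ ≤ ℓ.len ∧ ℓ.len ≤ δ := by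
  suffices h : ∀ (n : ℕ) (ℓ : RauzyStage T β), κ * δ ≤ ℓ.len → ℓ.len ≤ 2 ^ n * δ →
      ∃ ℓ : RauzyStage T β, κ * δ ≤ ℓ.len ∧ ℓ.len ≤ δ by
    obtain ⟨n, hn⟩ := pow_unbounded_of_one_lt (ℓ₀.len / δ) (one_lt_two (α := ℝ))
    exact h n ℓ₀ h₀ ((div_le_iff₀ hδ).1 hn.le)
  intro n
  induction n with
  | zero => exact fun ℓ h h' => ⟨ℓ, h, by simpa using h'⟩
  | succ n ih =>
    intro ℓ h h'
    rcases le_or_gt ℓ.len δ with hle | hgt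
    · exact ⟨ℓ, h, hle⟩
    · obtain ⟨ℓ', g₁, g₂, n₁, n₂, hR⟩ := ℓ.exists_refines hne
      refine ih ℓ' ?_ ?_
      · rw [hR.len_eq]
        have : κ * δ ≤ κ * ℓ.len := by gcongr
        exact le_min (this.trans (hlen ℓ).1) (this.trans (hlen ℓ).2)
      · rw [hR.len_eq]
        have h1 := min_le_left ℓ.l₁ ℓ.l₂
        have h2 := min_le_right ℓ.l₁ ℓ.l₂
        rw [pow_succ] at h'
        have h3 : ℓ.len = ℓ.l₁ + ℓ.l₂ := rfl
        linarith

/-- Every orbit is `δ`-dense within time `C / δ`. -/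
theorem exists_dense_orbit [Fintype S] {κ : ℝ} (hκ : 0 < κ) (ℓ₀ : RauzyStage T β)
    (hlen : ∀ ℓ : RauzyStage T β, κ * ℓ.len ≤ ℓ.l₁ ∧ κ * ℓ.len ≤ ℓ.l₂)
    (hne : ∀ ℓ : RauzyStage T β, ℓ.l₁ ≠ ℓ.l₂) (h₀ : κ ≤ ℓ₀.len)
    (hmaps : Set.MapsTo T {z | z.2 ∈ Set.Ico (0 : ℝ) 1} {z | z.2 ∈ Set.Ico (0 : ℝ) 1})
    (hinj : Set.InjOn T {z | z.2 ∈ Set.Ico (0 : ℝ) 1}) :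
    ∃ C : ℝ, 0 < C ∧ ∀ δ : ℝ, 0 < δ → δ ≤ 1 → ∀ z : S × ℝ, z.2 ∈ Set.Ico (0 : ℝ) 1 →
      ∀ s, ∀ x ∈ Set.Ico (0 : ℝ) 1, ∃ t : ℕ, t ≤ C / δ ∧ ∃ y, |y - x| < δ ∧ T^[t] z = (s, y) := by
  rcases isEmpty_or_nonempty S with hS | hS
  · exact ⟨1, one_pos, fun _ _ _ _ _ s => hS.elim s⟩
  have hcard : Fintype.card S - 1 + 1 = Fintype.card S := Nat.sub_add_cancel Fintype.card_pos
  obtain ⟨K, hK, hvis⟩ := exists_card_visited (T := T) (β := β) hκ hlen hne hmaps hinj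
    (Fintype.card S - 1) hcard.le
  refine ⟨(K + 2 / κ) / κ / κ, by positivity, fun δ hδ hδ1 z hz s x hx => ?_⟩
  obtain ⟨ℓ, hℓ1, hℓ2⟩ := exists_len_mem hκ hδ ℓ₀ hlen hne (by nlinarith)
  obtain ⟨ℓ', g₁, g₂, n₁, n₂, hR⟩ := ℓ.exists_refines hne
  have hl := ℓ.len_pos
  have hl' := ℓ'.len_pos
  have hle : κ * ℓ.len ≤ ℓ'.len := by
    rw [hR.len_eq]; exact le_min (hlen ℓ).1 (hlen ℓ).2
  have hll : ℓ'.len ≤ ℓ.l₁ ∧ ℓ'.len ≤ ℓ.l₂ := by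
    rw [hR.len_eq]; exact ⟨min_le_left _ _, min_le_right _ _⟩
  have hle' : ℓ'.len ≤ ℓ.len := hll.1.trans (by rw [len]; linarith [ℓ.pos₂])
  have hh := ℓ.height_le hκ (hlen ℓ)
  have hbound : K / ℓ'.len + 1 / κ / ℓ.len + 1 / κ / ℓ.len ≤ (K + 2 / κ) / κ / κ / δ := by
    have h1 : 1 / κ / ℓ.len ≤ 1 / κ / ℓ'.len := by gcongr
    have h2 : K / ℓ'.len + 1 / κ / ℓ'.len + 1 / κ / ℓ'.len = (K + 2 / κ) / ℓ'.len := by ring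
    have h3 : (K + 2 / κ) / ℓ'.len ≤ (K + 2 / κ) / (κ * (κ * δ)) := by
      gcongr
      exact le_trans (by gcongr) hle
    have h4 : (K + 2 / κ) / κ / κ / δ = (K + 2 / κ) / (κ * (κ * δ)) := by
      rw [div_div, div_div]
    linarith
  have p0 : 0 ≤ 1 / κ / ℓ.len := by positivity
  have hiter : ∀ n, (T^[n] z).2 ∈ Set.Ico (0 : ℝ) 1 := fun n => hmaps.iterate n hz
  have hall : ∀ (w : S × ℝ), w.2 ∈ Set.Ico (0 : ℝ) 1 → ∀ r, ∃ t : ℕ, t ≤ K / ℓ'.len ∧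
      ∃ y ∈ Set.Ico 0 ℓ'.len, T^[t] w = (r, y) := fun w hw r => by
    obtain ⟨V, hV, hvis⟩ := hvis ℓ' w hw
    refine hvis r ?_
    rw [hcard] at hV
    rw [Finset.card_eq_iff_eq_univ V |>.1 (le_antisymm (Finset.card_le_univ V) hV)]
    exact Finset.mem_univ r
  have hlen_def : ℓ.len = ℓ.l₁ + ℓ.l₂ := rfl
  rcases ℓ.tower s x hx with ⟨j, hj, r, d, hd, hT⟩ | ⟨j, hj, r, d, hd, hT⟩
  · obtain ⟨t, ht, y, hy, hty⟩ := hall z hz r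
    refine ⟨j + t, ?_, y + d, ?_, ?_⟩
    · have : (j : ℝ) ≤ ℓ.h₁ := by exact_mod_cast hj.le
      push_cast; linarith [hh.1]
    · rw [abs_lt]
      constructor <;> linarith [hd.1, hd.2, hy.1, hy.2, ℓ.pos₂, hll.1]
    · rw [Function.iterate_add_apply, hty, hT y ⟨hy.1, hy.2.trans_le hll.1⟩]
  · -- a visit to `[0, l₂)` in the fibre `τ r` comes from a visit to `[l₁, l₁ + l₂)` in the fibre `r`
    obtain ⟨t, ht, y, hy, hty⟩ := hall (T^[ℓ.h₂] z) (hiter _) (ℓ.τ r)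
    have hmem : y + ℓ.l₁ ∈ Set.Ico ℓ.l₁ (ℓ.l₁ + ℓ.l₂) :=
      ⟨by linarith [hy.1], by linarith [hy.2, hll.2]⟩
    have hback : T^[t] z = (r, y + ℓ.l₁) := by
      refine hinj.iterate hmaps ℓ.h₂ (hiter t) ?_ ?_
      · exact ⟨by linarith [hmem.1, ℓ.pos₁], lt_of_lt_of_le hmem.2 ℓ.len_le_one⟩
      · rw [ℓ.return₂ _ _ hmem, add_sub_cancel_right, ← hty, ← Function.iterate_add_apply,
          ← Function.iterate_add_apply, add_comm]
    refine ⟨j + t, ?_, y + ℓ.l₁ + d, ?_, ?_⟩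
    · have : (j : ℝ) ≤ ℓ.h₂ := by exact_mod_cast hj.le
      push_cast; linarith [hh.2]
    · rw [abs_lt]
      constructor <;> linarith [hd.1, hd.2, hmem.1, hmem.2, ℓ.pos₁]
    · rw [Function.iterate_add_apply, hback, hT _ hmem]

end RauzyStage

/-! ### The skew rotation -/

section

variable {S : Type*} (ρ υ : Equiv.Perm S) (β : ℝ)

theorem skewRotation_mapsTo : Set.MapsTo (skewRotation ρ υ β)
    {z | z.2 ∈ Set.Ico (0 : ℝ) 1} {z | z.2 ∈ Set.Ico (0 : ℝ) 1} :=
  fun _ _ => ⟨Int.fract_nonneg _, Int.fract_lt_one _⟩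

theorem skewRotation_injOn :
    Set.InjOn (skewRotation ρ υ β) {z | z.2 ∈ Set.Ico (0 : ℝ) 1} := by
  rintro ⟨a, x⟩ hx ⟨b, y⟩ hy h
  simp only [skewRotation, Prod.mk.injEq] at h
  obtain ⟨h1, h2⟩ := h
  have hxy : x = y := by
    obtain ⟨n, hn⟩ := Int.fract_eq_fract.1 h2
    have h3 : x - y = n := by linarith
    have h4 : (-1 : ℝ) < n := by rw [← h3]; linarith [hx.1, hy.2]
    have h5 : (n : ℝ) < 1 := by rw [← h3]; linarith [hx.2, hy.1]
    have h6 : n = 0 := by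
      have h4' : -1 < n := by exact_mod_cast h4
      have h5' : n < 1 := by exact_mod_cast h5
      omega
    rw [h6] at h3
    push_cast at h3
    linarith
  subst hxy
  simpa using h1

variable {ρ υ β}

/-- The initial stage of Rauzy induction: the rotation as an exchange of two intervals. -/
def skewRotationStage (hβ : Irrational β) (htr : JointlyTransitive ρ υ) :
    RauzyStage (skewRotation ρ υ β) β where
  l₁ := 1 - Int.fract β
  l₂ := Int.fract β
  h₁ := 1
  h₂ := 1
  σ := ρ * υ ^ ⌊β⌋
  τ := ρ * υ ^ (⌊β⌋ + 1)
  pos₁ := sub_pos.2 (Int.fract_lt_one β)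
  pos₂ := Int.fract_pos.2 (hβ.ne_int _)
  h₁_pos := one_pos
  h₂_pos := one_pos
  return₁ s x hx := by
    have hfl : ⌊x + β⌋ = ⌊β⌋ := by
      rw [Int.floor_eq_iff]
      have := Int.floor_add_fract β
      constructor <;> linarith [hx.1, hx.2, Int.fract_nonneg β]
    simp only [Function.iterate_one, skewRotation, hfl, Int.fract, Equiv.Perm.mul_apply]
    congr 1; ring
  return₂ s x hx := by
    have hfl : ⌊x + β⌋ = ⌊β⌋ + 1 := by
      rw [Int.floor_eq_iff]
      have := Int.floor_add_fract β
      push_cast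
      constructor <;> linarith [hx.1, hx.2, Int.fract_lt_one β]
    simp only [Function.iterate_one, skewRotation, hfl, Int.fract, Equiv.Perm.mul_apply]
    congr 1; push_cast; ring
  tower s x hx := by
    rcases lt_or_ge x (1 - Int.fract β) with h | h
    · exact Or.inl ⟨0, one_pos, s, 0, by simpa using ⟨hx.1, h⟩, fun z _ => by simp⟩
    · exact Or.inr ⟨0, one_pos, s, 0, by simpa using ⟨by linarith, hx.2⟩, fun z _ => by simp⟩
  transitive V hσ hτ := by
    have hυ : ∀ s, υ s ∈ V ↔ s ∈ V := fun s => by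
      rw [← hσ, ← hτ s, zpow_add, zpow_one]; rfl
    have hpow : ∀ (n : ℕ) s, (υ ^ n) s ∈ V ↔ s ∈ V := fun n => by
      induction n with
      | zero => simp
      | succ n ih => exact fun s => by rw [pow_succ, Equiv.Perm.mul_apply, ih, hυ]
    have hzpow : ∀ (n : ℤ) s, (υ ^ n) s ∈ V ↔ s ∈ V := fun n s => by
      obtain ⟨m, rfl | rfl⟩ := n.eq_nat_or_neg
      · exact hpow m s
      · rw [← hpow m ((υ ^ (-(m : ℤ))) s), ← Equiv.Perm.mul_apply, zpow_neg, zpow_natCast,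
          mul_inv_cancel, Equiv.Perm.one_apply]
    refine htr V (fun s => ?_) hυ
    have := hσ ((υ ^ (-⌊β⌋)) s)
    rwa [hzpow, ← Equiv.Perm.mul_apply, mul_assoc, ← zpow_add, add_neg_cancel, zpow_zero,
      mul_one] at this
  l₁_eq := ⟨1 + ⌊β⌋, by rw [Int.fract]; push_cast; ring⟩
  l₂_eq := ⟨⌊β⌋, by rw [Int.fract]; push_cast; ring⟩
  area := by push_cast; ring

/-- Orbits of a transitive skew product over a badly approximable rotation are `δ`-dense within a
time proportional to `1 / δ`. -/
theorem skewRotation_dense_orbit [Finite S] (htr : JointlyTransitive ρ υ) {c : ℝ} (hc : 0 < c)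
    (hirr : Irrational β) (hβ : ∀ (p : ℤ) (q : ℕ), 0 < q → c / q ≤ |q * β - p|) :
    ∃ C : ℝ, 0 < C ∧ ∀ δ : ℝ, 0 < δ → δ ≤ 1 → ∀ z : S × ℝ, z.2 ∈ Set.Ico (0 : ℝ) 1 →
      ∀ s, ∀ x ∈ Set.Ico (0 : ℝ) 1,
        ∃ t : ℕ, t ≤ C / δ ∧ ∃ y, |y - x| < δ ∧ (skewRotation ρ υ β)^[t] z = (s, y) := by
  have := Fintype.ofFinite S
  refine RauzyStage.exists_dense_orbit (κ := c / (1 + c)) (by positivity)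
    (skewRotationStage hirr htr) (fun ℓ => ℓ.mul_len_le hc hβ) (fun ℓ => ℓ.l₁_ne_l₂ hc hβ) ?_
    (skewRotation_mapsTo ρ υ β) (skewRotation_injOn ρ υ β)
  have : (skewRotationStage hirr htr).len = 1 := by
    simp [RauzyStage.len, skewRotationStage]
  rw [this, div_le_one (by linarith)]
  linarith

end

namespace PolysquareSurface

variable {S : Type*} {P : PolysquareSurface S}

/-! ### Continuation of geodesics inside a square -/

/-- Away from the vertices at most two points of the closed squares are identified. -/
theorem eq_or_glue_of_eqvGen {z w : S × UnitSquare} (h : Relation.EqvGen P.Glue z w)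
    (hz : ¬ P.IsVertex (Quot.mk _ z)) : z = w ∨ P.Glue z w ∨ P.Glue w z := by
  have corner : ∀ (a : S) (p : UnitSquare), ¬ P.IsVertex (Quot.mk _ (a, p)) →
      (p.1 0 = 0 ∨ p.1 0 = 1) → (p.1 1 = 0 ∨ p.1 1 = 1) → False := fun a p hv h0 h1 =>
    hv ⟨a, p, fun i => by fin_cases i <;> assumption, rfl⟩
  have ext : ∀ p q : UnitSquare, p.1 0 = q.1 0 → p.1 1 = q.1 1 → p = q := fun p q h0 h1 => by
    rw [← sq_eta p, ← sq_eta q]; simp only [h0, h1]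
  induction h with
  | rel z w h => exact Or.inr (Or.inl h)
  | refl z => exact Or.inl rfl
  | symm z w h ih =>
    have e : Quot.mk P.Glue z = Quot.mk P.Glue w := Quot.eqvGen_sound h
    rcases ih (e ▸ hz) with h | h | h
    · exact Or.inl h.symm
    · exact Or.inr (Or.inr h)
    · exact Or.inr (Or.inl h)
  | trans z w u h h' ih ih' =>
    have e : Quot.mk P.Glue z = Quot.mk P.Glue w := Quot.eqvGen_sound h
    have hw : ¬ P.IsVertex (Quot.mk _ w) := e ▸ hz
    rcases ih hz with rfl | h | h
    · exact ih' hw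
    · rcases ih' hw with rfl | h' | h'
      · exact Or.inr (Or.inl h)
      · exfalso
        cases h with
        | right a p q hp hq hpq =>
          cases h' with
          | right _ _ r hq' hr hqr => linarith
          | up _ _ r hq' hr hqr => exact corner _ _ hw (Or.inl hq) (Or.inr hq')
        | up a p q hp hq hpq =>
          cases h' with
          | right _ _ r hq' hr hqr => exact corner _ _ hw (Or.inr hq') (Or.inl hq)
          | up _ _ r hq' hr hqr => linarith
      · left
        obtain ⟨b, q⟩ := w
        generalize hbq : (b, q) = w' at h
        cases h with
        | right a p q' hp hq hpq =>
          obtain ⟨rfl, rfl⟩ := Prod.mk.inj hbq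
          generalize hbq' : (P.right a, q) = w' at h'
          cases h' with
          | right c r q' hr hq' hrq =>
            obtain ⟨h1, rfl⟩ := Prod.mk.inj hbq'
            rw [P.right.injective h1, ext p r (by rw [hp, hr]) (by rw [hpq, hrq])]
          | up c r q' hr hq' hrq =>
            obtain ⟨h1, rfl⟩ := Prod.mk.inj hbq'
            exact (corner _ _ hw (Or.inl hq) (Or.inl hq')).elim
        | up a p q' hp hq hpq =>
          obtain ⟨rfl, rfl⟩ := Prod.mk.inj hbq
          generalize hbq' : (P.up a, q) = w' at h'
          cases h' with
          | right c r q' hr hq' hrq =>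
            obtain ⟨h1, rfl⟩ := Prod.mk.inj hbq'
            exact (corner _ _ hw (Or.inl hq') (Or.inl hq)).elim
          | up c r q' hr hq' hrq =>
            obtain ⟨h1, rfl⟩ := Prod.mk.inj hbq'
            rw [P.up.injective h1, ext p r (by rw [hpq, hrq]) (by rw [hp, hr])]
    · rcases ih' hw with rfl | h' | h'
      · exact Or.inr (Or.inr h)
      · left
        cases h with
        | right a p q hp hq hpq =>
          cases h' with
          | right _ _ r hp' hr hpr => rw [ext q r (by rw [hq, hr]) (by rw [← hpq, hpr])]
          | up _ _ r hp' hr hpr => exact (corner _ _ hw (Or.inr hp) (Or.inr hp')).elim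
        | up a p q hp hq hpq =>
          cases h' with
          | right _ _ r hp' hr hpr => exact (corner _ _ hw (Or.inr hp') (Or.inr hp)).elim
          | up _ _ r hp' hr hpr => rw [ext q r (by rw [← hpq, hpr]) (by rw [hq, hr])]
      · exfalso
        cases h' with
        | right a p q hp hq hpq =>
          cases h with
          | right _ _ r hq' hr hqr => linarith
          | up _ _ r hq' hr hqr => exact corner _ _ hw (Or.inl hq) (Or.inr hq')
        | up a p q hp hq hpq =>
          cases h with
          | right _ _ r hq' hr hqr => exact corner _ _ hw (Or.inr hq') (Or.inl hq)
          | up _ _ r hq' hr hqr => linarith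

/-- Two segments with the same velocity, not parallel to an edge, that start at the same
non-vertex point agree: glued boundary points lie on opposite edges, and the velocity cannot point
into the square at both of them. -/
theorem eq_of_segments {v : Plane} (hv : ∀ i, v i ≠ 0) {a b : S} {p q : Plane} {t t' : ℝ}
    (htt' : t < t') (hp : p + t • v ∈ UnitSquare) (hq : q + t • v ∈ UnitSquare)
    (hp' : p + t' • v ∈ UnitSquare) (hq' : q + t' • v ∈ UnitSquare)
    (h : P.pt a ⟨p + t • v, hp⟩ = P.pt b ⟨q + t • v, hq⟩)
    (hvert : ¬ P.IsVertex (P.pt a ⟨p + t • v, hp⟩)) : a = b ∧ p = q := by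
  have key : ∀ (p q : Plane) (i : Fin 2), p + t' • v ∈ UnitSquare → q + t' • v ∈ UnitSquare →
      (p + t • v) i = 1 → (q + t • v) i = 0 → False := fun p q i hp' hq' h1 h0 => by
    have h2 := (hp' i).2
    have h3 := (hq' i).1
    simp only [PiLp.add_apply, PiLp.smul_apply, smul_eq_mul] at h1 h0 h2 h3
    have h4 : (t' - t) * v i ≤ 0 := by linarith
    have h5 : 0 ≤ (t' - t) * v i := by linarith
    rcases mul_eq_zero.1 (le_antisymm h4 h5) with h6 | h6
    · linarith
    · exact hv i h6
  rcases eq_or_glue_of_eqvGen (Quot.eqvGen_exact h) hvert with h | h | h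
  · obtain ⟨h1, h2⟩ := Prod.mk.inj h
    exact ⟨h1, add_right_cancel (Subtype.mk.inj h2)⟩
  · exfalso
    cases h with
    | right _ _ _ h1 h0 _ => exact key p q 0 hp' hq' h1 h0
    | up _ _ _ h1 h0 _ => exact key p q 1 hp' hq' h1 h0
  · exfalso
    generalize hz : (a, (⟨p + t • v, hp⟩ : UnitSquare)) = z at h
    generalize hw : (b, (⟨q + t • v, hq⟩ : UnitSquare)) = w at h
    cases h with
    | right c r r' h1 h0 _ =>
      obtain ⟨-, rfl⟩ := Prod.mk.inj hz
      obtain ⟨-, rfl⟩ := Prod.mk.inj hw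
      exact key q p 0 hq' hp' h1 h0
    | up c r r' h1 h0 _ =>
      obtain ⟨-, rfl⟩ := Prod.mk.inj hz
      obtain ⟨-, rfl⟩ := Prod.mk.inj hw
      exact key q p 1 hq' hp' h1 h0

/-- A geodesic that avoids the vertices and is not parallel to an edge stays on its line as long as
this line stays in the square. -/
theorem IsGeodesic.eq_pt_of_mem {v : Plane} {L : ℝ → P.Point} (hL : P.IsGeodesic v L)
    (hvertex : ∀ t : ℝ, 0 ≤ t → ¬ P.IsVertex (L t)) (hv : ∀ i, v i ≠ 0) {a : S} {p : Plane}
    {t₀ τ : ℝ} (ht₀ : 0 ≤ t₀) (hτ : 0 ≤ τ) (hp : ∀ s ∈ Set.Icc 0 τ, p + s • v ∈ UnitSquare)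
    (h0 : ∀ h, L t₀ = P.pt a ⟨p + (0 : ℝ) • v, h⟩) :
    L (t₀ + τ) = P.pt a ⟨p + τ • v, hp τ ⟨hτ, le_rfl⟩⟩ := by
  have hshift : ∀ (q : Plane) (s : ℝ), q + (t₀ + s) • v = (q + t₀ • v) + s • v := fun q s => by
    rw [add_smul, add_assoc]
  refine forall_mem_Icc_of_local (a := 0) (b := τ)
    (R := fun s => ∀ h, L (t₀ + s) = P.pt a ⟨p + s • v, h⟩) (by simpa using h0) ?_ ?_
      τ ⟨hτ, le_rfl⟩ _
  · intro s hs hsτ hR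
    obtain ⟨ε, hε, b, q, hq⟩ := (hL.2 (t₀ + s) (by linarith)).1
    refine ⟨ε, hε, fun r h1 h2 h3 h => ?_⟩
    obtain ⟨m1, e1⟩ := hq (t₀ + s) ⟨le_rfl, by linarith⟩
    obtain ⟨m2, e2⟩ := hq (t₀ + r) ⟨by linarith, by linarith⟩
    have hs' := hp s ⟨hs, hsτ.le⟩
    have e0 := hR hs'
    simp only [hshift] at m1 e1 m2 e2
    obtain ⟨rfl, rfl⟩ := eq_of_segments hv h1 hs' m1 h m2 (e0 ▸ e1)
      (e0 ▸ hvertex _ (by linarith))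
    exact e2
  · intro s hs hsτ hR h
    obtain ⟨ε, hε, b, q, hq⟩ := (hL.2 (t₀ + s) (by linarith)).2 (by linarith)
    set r := max 0 (s - ε) with hr
    have hr0 : 0 ≤ r := le_max_left _ _
    have hrs : r < s := max_lt hs (by linarith)
    have hrε : s - ε ≤ r := le_max_right _ _
    obtain ⟨m1, e1⟩ := hq (t₀ + r) ⟨by linarith, by linarith⟩
    obtain ⟨m2, e2⟩ := hq (t₀ + s) ⟨by linarith, le_rfl⟩
    have hr' := hp r ⟨hr0, by linarith⟩
    have e0 := hR r hr0 hrs hr'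
    simp only [hshift] at m1 e1 m2 e2
    obtain ⟨rfl, rfl⟩ := eq_of_segments hv hrs hr' m1 h m2 (e0 ▸ e1)
      (e0 ▸ hvertex _ (by linarith))
    exact e2

/-! ### Reflected coordinates -/

/-- The coordinate `x` of the unit interval, measured from the right end if `e` is true. -/
def reflect (e : Bool) (x : ℝ) : ℝ := if e then 1 - x else x

theorem reflect_mem {e : Bool} {x : ℝ} (hx : x ∈ Set.Icc (0 : ℝ) 1) :
    reflect e x ∈ Set.Icc (0 : ℝ) 1 := by
  cases e
  · simpa [reflect] using hx
  · simpa [reflect] using ⟨hx.2, hx.1⟩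

theorem reflect_reflect (e : Bool) (x : ℝ) : reflect e (reflect e x) = x := by
  cases e <;> simp [reflect]

/-- The inverse of `g` if `e` is true, and `g` otherwise. -/
def orient (e : Bool) (g : Equiv.Perm S) : Equiv.Perm S := if e then g⁻¹ else g

/-- The point of the square `a` with coordinates `x`, `y` after a horizontal reflection of the
squares if `e` is true and a vertical one if `f` is true. With a suitable choice of `e` and `f` the
direction of a given geodesic becomes positive. Coordinates outside `[0, 1]` are clamped. -/
def reflectedPt (P : PolysquareSurface S) (e f : Bool) (a : S) (x y : ℝ) : P.Point :=
  P.pt a (sq (reflect e (Set.projIcc 0 1 zero_le_one x)) (reflect f (Set.projIcc 0 1 zero_le_one y))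
    (reflect_mem (Subtype.property _)) (reflect_mem (Subtype.property _)))

variable {e f : Bool}

theorem reflectedPt_of_mem (a : S) {x y : ℝ} (hx : x ∈ Set.Icc (0 : ℝ) 1)
    (hy : y ∈ Set.Icc (0 : ℝ) 1) :
    P.reflectedPt e f a x y = P.pt a (sq (reflect e x) (reflect f y)
      (reflect_mem hx) (reflect_mem hy)) := by
  simp only [reflectedPt, Set.projIcc_of_mem zero_le_one hx, Set.projIcc_of_mem zero_le_one hy]

theorem exists_reflectedPt_eq (e f : Bool) (x : P.Point) :
    ∃ a, ∃ ξ ∈ Set.Icc (0 : ℝ) 1, ∃ η ∈ Set.Icc (0 : ℝ) 1, x = P.reflectedPt e f a ξ η := by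
  obtain ⟨⟨a, p⟩, rfl⟩ := Quot.exists_rep x
  refine ⟨a, reflect e (p.1 0), reflect_mem (p.2 0), reflect f (p.1 1), reflect_mem (p.2 1), ?_⟩
  rw [reflectedPt_of_mem a (reflect_mem (p.2 0)) (reflect_mem (p.2 1))]
  simp only [reflect_reflect, sq_eta]
  rfl

theorem reflectedPt_right (a : S) {y : ℝ} (hy : y ∈ Set.Icc (0 : ℝ) 1) :
    P.reflectedPt e f a 1 y = P.reflectedPt e f (orient e P.right a) 0 y := by
  have m0 : (0 : ℝ) ∈ Set.Icc (0 : ℝ) 1 := by simp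
  have m1 : (1 : ℝ) ∈ Set.Icc (0 : ℝ) 1 := by simp
  rw [reflectedPt_of_mem a m1 hy, reflectedPt_of_mem _ m0 hy]
  cases e
  · simpa [reflect, orient] using pt_right a m1 m0 (reflect_mem hy)
  · have := (pt_right (P := P) (P.right.symm a) m1 m0 (reflect_mem (e := f) hy)).symm
    rw [Equiv.apply_symm_apply] at this
    simpa [reflect, orient] using this

theorem reflectedPt_up (a : S) {x : ℝ} (hx : x ∈ Set.Icc (0 : ℝ) 1) :
    P.reflectedPt e f a x 1 = P.reflectedPt e f (orient f P.up a) x 0 := by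
  have m0 : (0 : ℝ) ∈ Set.Icc (0 : ℝ) 1 := by simp
  have m1 : (1 : ℝ) ∈ Set.Icc (0 : ℝ) 1 := by simp
  rw [reflectedPt_of_mem a hx m1, reflectedPt_of_mem _ hx m0]
  cases f
  · simpa [reflect, orient] using pt_up a m1 m0 (reflect_mem hx)
  · have := (pt_up (P := P) (P.up.symm a) m1 m0 (reflect_mem (e := e) hx)).symm
    rw [Equiv.apply_symm_apply] at this
    simpa [reflect, orient] using this

theorem flatDist_reflectedPt_le (a : S) {x y y' : ℝ} (hx : x ∈ Set.Icc (0 : ℝ) 1)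
    (hy : y ∈ Set.Icc (0 : ℝ) 1) (hy' : y' ∈ Set.Icc (0 : ℝ) 1) :
    P.flatDist (P.reflectedPt e f a x y) (P.reflectedPt e f a x y') ≤ |y - y'| := by
  rw [reflectedPt_of_mem a hx hy, reflectedPt_of_mem a hx hy']
  refine (flatDist_pt_pt_le a _ _).trans ?_
  rw [Subtype.dist_eq, EuclideanSpace.dist_eq]
  simp only [Fin.sum_univ_two, sq, Matrix.cons_val_zero, Matrix.cons_val_one,
    Real.dist_eq, sq_abs]
  rw [sub_self, zero_pow two_ne_zero, zero_add, Real.sqrt_sq_eq_abs]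
  cases f
  · simp [reflect]
  · simp [reflect, abs_sub_comm]

theorem orient_mem_iff {e : Bool} {g : Equiv.Perm S} {V : Set S}
    (h : ∀ s, orient e g s ∈ V ↔ s ∈ V) (s : S) : g s ∈ V ↔ s ∈ V := by
  cases e
  · simpa [orient] using h s
  · have := h (g s)
    simp only [orient, if_true] at this
    rw [← this, ← Equiv.Perm.mul_apply, inv_mul_cancel, Equiv.Perm.one_apply]

theorem jointlyTransitive_orient (P : PolysquareSurface S) (e f : Bool) :
    JointlyTransitive (orient e P.right) (orient f P.up) := by
  rintro V hr hu ⟨a, ha⟩ b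
  suffices h : ∀ a b, Relation.EqvGen (fun c d => d = P.right c ∨ d = P.up c) a b →
      (a ∈ V ↔ b ∈ V) from (h a b (P.connected a b)).1 ha
  intro a b h
  induction h with
  | rel a b h =>
    rcases h with rfl | rfl
    · exact (orient_mem_iff hr a).symm
    · exact (orient_mem_iff hu a).symm
  | refl a => rfl
  | symm a b _ ih => exact ih.symm
  | trans a b c _ _ ih ih' => exact ih.trans ih'

/-! ### The first return map to the vertical edges -/

variable {v : Plane} {L : ℝ → P.Point} {w₀ w₁ : ℝ}

theorem IsGeodesic.eq_reflectedPt (hL : P.IsGeodesic v L)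
    (hvertex : ∀ t : ℝ, 0 ≤ t → ¬ P.IsVertex (L t)) (hw₀ : 0 < w₀) (hw₁ : 0 < w₁)
    (hv₀ : v 0 = if e then -w₀ else w₀) (hv₁ : v 1 = if f then -w₁ else w₁)
    {a : S} {x y t s : ℝ} (ht : 0 ≤ t) (hs : 0 ≤ s) (hx : 0 ≤ x) (hy : 0 ≤ y)
    (hx' : x + s * w₀ ≤ 1) (hy' : y + s * w₁ ≤ 1) (h : L t = P.reflectedPt e f a x y) :
    L (t + s) = P.reflectedPt e f a (x + s * w₀) (y + s * w₁) := by
  have mem : ∀ r ∈ Set.Icc 0 s, x + r * w₀ ∈ Set.Icc (0 : ℝ) 1 ∧ y + r * w₁ ∈ Set.Icc (0 : ℝ) 1 :=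
    fun r hr => by
      have h1 : 0 ≤ r * w₀ := mul_nonneg hr.1 hw₀.le
      have h2 : 0 ≤ r * w₁ := mul_nonneg hr.1 hw₁.le
      have h3 : r * w₀ ≤ s * w₀ := by gcongr; exact hr.2
      have h4 : r * w₁ ≤ s * w₁ := by gcongr; exact hr.2
      exact ⟨⟨by linarith, by linarith⟩, ⟨by linarith, by linarith⟩⟩
  have heq : ∀ r : ℝ, !₂[reflect e x, reflect f y] + r • v =
      !₂[reflect e (x + r * w₀), reflect f (y + r * w₁)] := fun r => by
    ext i
    fin_cases i
    · simp [hv₀, reflect]; split_ifs <;> ring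
    · simp [hv₁, reflect]; split_ifs <;> ring
  have hin : ∀ r ∈ Set.Icc 0 s, !₂[reflect e x, reflect f y] + r • v ∈ UnitSquare :=
    fun r hr => by
      rw [heq]
      exact (sq _ _ (reflect_mem (mem r hr).1) (reflect_mem (mem r hr).2)).2
  have hv : ∀ i, v i ≠ 0 := fun i => by
    fin_cases i
    · simp only [Fin.zero_eta, hv₀]; split_ifs <;> simp [hw₀.ne']
    · simp only [Fin.mk_one, hv₁]; split_ifs <;> simp [hw₁.ne']
  rw [hL.eq_pt_of_mem hvertex hv (a := a) ht hs hin, reflectedPt_of_mem a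
    (mem s ⟨hs, le_rfl⟩).1 (mem s ⟨hs, le_rfl⟩).2]
  · simp only [heq, sq]
  · intro h'
    have m := mem 0 ⟨le_rfl, hs⟩
    simp only [zero_mul, add_zero] at m
    rw [h, reflectedPt_of_mem a m.1 m.2]
    simp only [heq, sq, zero_mul, add_zero]

/-- The motion until the next vertical edge crosses `k` horizontal edges. -/
theorem IsGeodesic.eq_reflectedPt_crossing (hL : P.IsGeodesic v L)
    (hvertex : ∀ t : ℝ, 0 ≤ t → ¬ P.IsVertex (L t)) (hw₀ : 0 < w₀) (hw₁ : 0 < w₁)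
    (hv₀ : v 0 = if e then -w₀ else w₀) (hv₁ : v 1 = if f then -w₁ else w₁) (k : ℕ)
    {a : S} {x y t s : ℝ} (ht : 0 ≤ t) (hs : 0 ≤ s) (hx : 0 ≤ x) (hy : 0 ≤ y) (hy1 : y ≤ 1)
    (hx' : x + s * w₀ ≤ 1) (hk : k ≤ y + s * w₁) (hk' : y + s * w₁ ≤ k + 1)
    (h : L t = P.reflectedPt e f a x y) :
    L (t + s) =
      P.reflectedPt e f ((orient f P.up ^ k) a) (x + s * w₀) (y + s * w₁ - k) := by
  induction k generalizing a x y t s with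
  | zero =>
    simpa using hL.eq_reflectedPt hvertex hw₀ hw₁ hv₀ hv₁ ht hs hx hy hx' (by simpa using hk') h
  | succ k ih =>
    push_cast at hk hk'
    set r := (1 - y) / w₁ with hr
    have hrw : r * w₁ = 1 - y := by rw [hr]; field_simp
    have hr0 : 0 ≤ r := div_nonneg (by linarith) hw₁.le
    have hrs : r ≤ s := by
      rw [hr, div_le_iff₀ hw₁]
      have : (0 : ℝ) ≤ k := k.cast_nonneg
      linarith
    have hrw0 : 0 ≤ r * w₀ := by positivity
    have hsw : (s - r) * w₀ = s * w₀ - r * w₀ := by ring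
    have hsw' : (s - r) * w₁ = s * w₁ - (1 - y) := by rw [sub_mul, hrw]
    have hsr : 0 ≤ (s - r) * w₀ := mul_nonneg (sub_nonneg.2 hrs) hw₀.le
    have h1 := hL.eq_reflectedPt hvertex hw₀ hw₁ hv₀ hv₁ ht hr0 hx hy (by linarith)
      (by rw [hrw]; linarith) h
    rw [hrw, add_sub_cancel, reflectedPt_up a ⟨by linarith, by linarith⟩] at h1
    have h2 := ih (by linarith) (sub_nonneg.2 hrs) (by linarith) le_rfl zero_le_one
      (by linarith) (by linarith) (by linarith) h1
    rw [pow_succ, Equiv.Perm.mul_apply]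
    convert h2 using 2 <;> push_cast <;> linarith

/-- A geodesic follows the orbit of the skew rotation along the vertical edges. -/
theorem IsGeodesic.eq_iterate_skewRotation (hL : P.IsGeodesic v L)
    (hvertex : ∀ t : ℝ, 0 ≤ t → ¬ P.IsVertex (L t)) (hw₀ : 0 < w₀) (hw₁ : 0 < w₁)
    (hv₀ : v 0 = if e then -w₀ else w₀) (hv₁ : v 1 = if f then -w₁ else w₁)
    {z : S × ℝ} (hz : z.2 ∈ Set.Ico (0 : ℝ) 1) {t : ℝ} (ht : 0 ≤ t)
    (h : L t = P.reflectedPt e f z.1 0 z.2) (n : ℕ) :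
    L (t + n / w₀) = P.reflectedPt e f
      ((skewRotation (orient e P.right) (orient f P.up) (w₁ / w₀))^[n] z).1 0
      ((skewRotation (orient e P.right) (orient f P.up) (w₁ / w₀))^[n] z).2 := by
  induction n with
  | zero => simpa using h
  | succ n ih =>
    rw [Function.iterate_succ_apply']
    have hz' := (skewRotation_mapsTo (orient e P.right) (orient f P.up) (w₁ / w₀)).iterate n hz
    set z' := (skewRotation (orient e P.right) (orient f P.up) (w₁ / w₀))^[n] z
    have hβ : 1 / w₀ * w₁ = w₁ / w₀ := by ring
    have hpos : 0 ≤ z'.2 + w₁ / w₀ := add_nonneg hz'.1 (by positivity)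
    obtain ⟨k, hk⟩ := Int.eq_ofNat_of_zero_le (Int.floor_nonneg.2 hpos)
    have hk1 := Int.floor_le (z'.2 + w₁ / w₀)
    have hk2 := Int.lt_floor_add_one (z'.2 + w₁ / w₀)
    rw [hk] at hk1 hk2
    have h1 := hL.eq_reflectedPt_crossing hvertex hw₀ hw₁ hv₀ hv₁ k (s := 1 / w₀)
      (by positivity) (by positivity) le_rfl hz'.1 hz'.2.le (by field_simp; simp)
      (by rw [hβ]; exact_mod_cast hk1) (by rw [hβ]; exact_mod_cast hk2.le) ih
    rw [hβ, one_div_mul_cancel hw₀.ne', zero_add, reflectedPt_right] at h1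
    · have e1 : t + ((n + 1 : ℕ) : ℝ) / w₀ = t + n / w₀ + 1 / w₀ := by push_cast; ring
      rw [e1, h1]
      simp only [skewRotation, hk, Int.fract, zpow_natCast, Int.cast_natCast]
    · push_cast at hk1 hk2
      exact ⟨by linarith, by linarith⟩

/-! ### Sufficiency -/

/-- An interval of length `2 δ ≤ 1` contains one of length `δ` without interior integers. -/
theorem exists_subinterval_between_ints (u δ : ℝ) (hδ : 0 < δ) (hδ' : 2 * δ ≤ 1) :
    ∃ u' : ℝ, u ≤ u' ∧ u' + δ ≤ u + 2 * δ ∧ ∃ m : ℤ, m ≤ u' ∧ u' + δ ≤ m + 1 := by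
  by_cases h : ∃ m : ℤ, u < m ∧ m < u + δ
  · obtain ⟨m, h1, h2⟩ := h
    exact ⟨u + δ, by linarith, by linarith, m, h2.le, by linarith⟩
  · push Not at h
    refine ⟨u, le_rfl, by linarith, ⌊u⌋, Int.floor_le u, ?_⟩
    have := h (⌊u⌋ + 1) (by push_cast; exact Int.lt_floor_add_one u)
    push_cast at this
    exact this

theorem IsGeodesic.isSuperdense [Finite S] (hL : P.IsGeodesic v L)
    (hvertex : ∀ t : ℝ, 0 ≤ t → ¬ P.IsVertex (L t)) (hw₀ : 0 < w₀) (hw₁ : 0 < w₁)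
    (hv₀ : v 0 = if e then -w₀ else w₀) (hv₁ : v 1 = if f then -w₁ else w₁)
    (hirr : Irrational (w₁ / w₀)) {c : ℝ} (hc : 0 < c)
    (hβ : ∀ (p : ℤ) (q : ℕ), 0 < q → c / q ≤ |q * (w₁ / w₀) - p|) : P.IsSuperdense L := by
  obtain ⟨C, hC, hdense⟩ := skewRotation_dense_orbit (jointlyTransitive_orient P e f) hc hirr hβ
  set β := w₁ / w₀ with hβdef
  -- the first arrival at a vertical edge
  obtain ⟨t₀, ht₀, z, hz, hLz⟩ : ∃ t₀ : ℝ, 0 ≤ t₀ ∧ ∃ z : S × ℝ, z.2 ∈ Set.Ico (0 : ℝ) 1 ∧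
      L t₀ = P.reflectedPt e f z.1 0 z.2 := by
    obtain ⟨a, x, hx, y, hy, hxy⟩ := exists_reflectedPt_eq e f (L 0)
    set s := (1 - x) / w₀ with hs
    have hs0 : 0 ≤ s := div_nonneg (by linarith [hx.2]) hw₀.le
    have hsw : s * w₀ = 1 - x := by rw [hs]; field_simp
    have hpos : 0 ≤ y + s * w₁ := add_nonneg hy.1 (by positivity)
    obtain ⟨k, hk⟩ := Int.eq_ofNat_of_zero_le (Int.floor_nonneg.2 hpos)
    have hk1 := Int.floor_le (y + s * w₁)
    have hk2 := Int.lt_floor_add_one (y + s * w₁)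
    rw [hk] at hk1 hk2
    push_cast at hk1 hk2
    have h1 := hL.eq_reflectedPt_crossing hvertex hw₀ hw₁ hv₀ hv₁ k le_rfl hs0 hx.1 hy.1 hy.2
      (by linarith) hk1 hk2.le hxy
    rw [hsw, add_sub_cancel, reflectedPt_right _ ⟨by linarith, by linarith⟩, zero_add] at h1
    exact ⟨s, hs0, (_, _), ⟨by linarith, by linarith⟩, h1⟩
  refine ⟨t₀ + 4 * C / w₀ + 1 / w₀, by positivity, fun n hn x => ?_⟩
  have hn' : (1 : ℝ) ≤ n := by exact_mod_cast hn
  obtain ⟨b, ξ, hξ, η, hη, rfl⟩ := exists_reflectedPt_eq e f x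
  set δ : ℝ := 1 / (2 * n) with hδdef
  have hδ : 0 < δ := by positivity
  have h2δ : 2 * δ = 1 / n := by rw [hδdef]; field_simp
  have hδ' : 2 * δ ≤ 1 := by
    rw [h2δ, div_le_one (by linarith)]; exact hn'
  -- the window `[η', η' + 2 δ]` contains `η`; its backward image on the entry edge may be cut by a
  -- vertex, in which case only one half of it is used
  set η' := min η (1 - 2 * δ) with hη'
  have hη'0 : 0 ≤ η' := le_min hη.1 (by linarith)
  have hη'1 : η' ≤ 1 - 2 * δ := min_le_right _ _
  have hη'η : η' ≤ η := min_le_left _ _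
  have hηη' : η ≤ η' + 2 * δ := by
    rcases min_cases η (1 - 2 * δ) with ⟨h, -⟩ | ⟨h, -⟩
    · rw [hη', h]; linarith
    · rw [hη', h]; linarith [hη.2]
  have hβ0 : 0 < β := by positivity
  have hξβ : 0 ≤ ξ * β := mul_nonneg hξ.1 hβ0.le
  obtain ⟨u, hu1, hu2, m, hm1, hm2⟩ := exists_subinterval_between_ints (η' - ξ * β) δ hδ hδ'
  have hm0 : m ≤ 0 := by
    have : (m : ℝ) < 1 := by linarith
    have : m < 1 := by exact_mod_cast this
    omega
  obtain ⟨k, hk⟩ := Int.eq_ofNat_of_zero_le (neg_nonneg.2 hm0)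
  have hkm : (k : ℝ) = -m := by
    have : (k : ℤ) = -m := hk.symm
    exact_mod_cast this
  obtain ⟨N, hN, y, hy, hNy⟩ := hdense (δ / 2) (by positivity) (by linarith) z hz
    ((orient f P.up ^ k).symm b) (u + δ / 2 - m) ⟨by linarith, by linarith⟩
  rw [abs_lt] at hy
  have h1 := hL.eq_iterate_skewRotation hvertex hw₀ hw₁ hv₀ hv₁ hz ht₀ hLz N
  rw [← hβdef, hNy] at h1
  have hξw : ξ / w₀ * w₀ = ξ := by field_simp
  have hξw' : ξ / w₀ * w₁ = ξ * β := by rw [hβdef]; ring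
  have hξ0 : 0 ≤ ξ / w₀ := div_nonneg hξ.1 hw₀.le
  have h2 := hL.eq_reflectedPt_crossing hvertex hw₀ hw₁ hv₀ hv₁ k (s := ξ / w₀)
    (by positivity) hξ0 le_rfl (by linarith) (by linarith) (by rw [hξw]; linarith [hξ.2])
    (by rw [hξw']; linarith) (by rw [hξw']; linarith) h1
  rw [Equiv.apply_symm_apply, hξw, hξw', zero_add] at h2
  refine ⟨t₀ + N / w₀ + ξ / w₀, by positivity, ?_, ?_⟩
  · have e1 : C / (δ / 2) = 4 * C * n := by rw [hδdef]; field_simp; ring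
    rw [e1] at hN
    have e2 : N / w₀ ≤ 4 * C / w₀ * n := by
      rw [div_mul_eq_mul_div]; gcongr
    have e3 : ξ / w₀ ≤ 1 / w₀ := by gcongr; exact hξ.2
    have e4 : 1 / w₀ ≤ 1 / w₀ * n := le_mul_of_one_le_right (by positivity) hn'
    have e5 : t₀ ≤ t₀ * n := le_mul_of_one_le_right ht₀ hn'
    linarith
  · rw [h2]
    refine (flatDist_reflectedPt_le b hξ hη ⟨by linarith, by linarith⟩).trans ?_
    rw [← h2δ, abs_le]
    constructor <;> linarith

theorem IsGeodesic.isSuperdense_of_badlyApproximable [Finite S] (hL : P.IsGeodesic v L)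
    (hvertex : ∀ t : ℝ, 0 ≤ t → ¬ P.IsVertex (L t)) (hv : v 0 ≠ 0)
    (hα : BadlyApproximable (v 1 / v 0)) : P.IsSuperdense L := by
  have hv1 : v 1 ≠ 0 := fun h => hα.1 ⟨0, by simp [h]⟩
  have habs : |v 1| / |v 0| = |v 1 / v 0| := (abs_div _ _).symm
  obtain ⟨c, hc, h⟩ := hα.exists_le_abs_sub
  refine hL.isSuperdense (e := decide (v 0 < 0)) (f := decide (v 1 < 0)) hvertex (abs_pos.2 hv)
    (abs_pos.2 hv1) ?_ ?_ ?_ hc ?_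
  · rcases lt_or_ge (v 0) 0 with h | h
    · simp [h, abs_of_neg h]
    · simp [not_lt.2 h, abs_of_nonneg h]
  · rcases lt_or_ge (v 1) 0 with h | h
    · simp [h, abs_of_neg h]
    · simp [not_lt.2 h, abs_of_nonneg h]
  · rw [habs]
    rcases abs_choice (v 1 / v 0) with h | h <;> rw [h]
    · exact hα.1
    · exact hα.1.neg
  · rw [habs]
    intro p q hq
    rcases abs_choice (v 1 / v 0) with h' | h' <;> rw [h']
    · exact h p q hq
    · refine (h (-p) q hq).trans_eq ?_
      rw [← abs_neg]
      congr 1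
      push_cast
      ring

end PolysquareSurface

theorem theorem1 {S : Type*} [Finite S] (P : PolysquareSurface S) (v : Plane) (L : ℝ → P.Point)
    (hL : P.IsGeodesic v L) (hvertex : ∀ t : ℝ, 0 ≤ t → ¬ P.IsVertex (L t)) :
    P.IsSuperdense L ↔ (v 0 ≠ 0 ∧ BadlyApproximable (v 1 / v 0)) :=
  ⟨fun h => h.badlyApproximable hL,
    fun h => hL.isSuperdense_of_badlyApproximable hvertex h.1 h.2⟩

end
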